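/- Let $q\in(0,1)$ and $p=1-q$. For a nonempty interval $\Lambda\subseteq\mathbb Z$ (finite, a half-line, or $\mathbb Z$ itself) let $\Omega_\Lambda=\{0,1\}^\Lambda$ and let $\pi_\Lambda$ be the product over $x\in\Lambda$ of the Bernoulli measures giving mass $p$ to $1$ and mass $q$ to $0$. For $x\in\Lambda$ let $\sigma^x$ be the configuration $\sigma$ flipped at $x$, and put $c^\Lambda_x(\sigma)=1-\sigma(x+1)$ if $x+1\in\Lambda$ and $c^\Lambda_x(\sigma)=1$ if $x=\max\Lambda$. The East generator $\mathcal L_\Lambda$ is the closure in $L^2(\pi_\Lambda)$ of the operator $$\mathcal L_\Lambda f(\sigma)=\sum_{x\in\Lambda}c^\Lambda_x(\sigma)\,[(1-\sigma(x))p+\sigma(x)q]\,(f(\sigma^x)-f(\sigma))$$ on local functions $f$ (those depending on finitely many coordinates), and its spectral gap is $$\mathrm{gap}(\mathcal L_\Lambda)=\inf_{f\in\mathrm{Dom}(\mathcal L_\Lambda),\ f\ne\mathrm{const}}\frac{\mathcal D_\Lambda(f)}{\mathrm{Var}_{\pi_\Lambda}(f)},\qquad \mathcal D_\Lambda(f)=\frac12\sum_{x\in\Lambda}\int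 c^\Lambda_x(\sigma)\,[(1-\sigma(x))p+\sigma(x)q]\,(f(\sigma^x)-f(\sigma))^2\,d\pi_\Lambda(\sigma).$$ Write $\mathcal L=\mathcal L_{\mathbb Z}$ for the infinite-volume generator. Then: (i) for every $q\in(0,1)$, $0<\mathrm{gap}(\mathcal L)<\infty$; (ii) $\displaystyle\lim_{q\downarrow0}\frac{\log\bigl(\mathrm{gap}(\mathcal L)^{-1}\bigr)}{(\log(1/q))^2}=\frac1{2\log2}$; (iii) for every $q\in(0,1)$ and every nonempty interval $\Lambda\subseteq\mathbb Z$, $\mathrm{gap}(\mathcal L_\Lambda)\ge\mathrm{gap}(\mathcal L)$; more generally, $\mathrm{gap}(\mathcal L_\Lambda)\le\mathrm{gap}(\mathcal L_V)$ for all nonempty intervals $V\subseteq\Lambda\subseteq\mathbb Z$. -/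

import Mathlib

open MeasureTheory ProbabilityTheory Filter Topology
open scoped ENNReal

noncomputable section

namespace East

/-- The configuration space `{0,1}^Λ` of a set of sites `Λ ⊆ ℤ`; `σ x = true` means that the
site `x` is occupied (`σ(x) = 1`) and `σ x = false` that it is empty (`σ(x) = 0`). -/
abbrev Config (Λ : Set ℤ) : Type := Λ → Bool

/-- The occupation variable `σ(x) ∈ {0,1}` as a real number. -/
def occ {Λ : Set ℤ} (σ : Config Λ) (x : Λ) : ℝ := if σ x = true then 1 else 0

/-- The product over the sites of `Λ` of the Bernoulli measures with `P(σ(x) = 1) = 1 - q` and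
`P(σ(x) = 0) = q`. -/
def productMeasure (q : unitInterval) (Λ : Set ℤ) : Measure (Config Λ) :=
  Measure.infinitePi fun _ : Λ => bernoulliMeasure true false (unitInterval.symm q)

/-- The configuration `σ^x` obtained from `σ` by flipping the value at `x`. -/
def flipAt {Λ : Set ℤ} (σ : Config Λ) (x : Λ) : Config Λ := Function.update σ x (!σ x)

open Classical in
/-- The constraint `c_x^Λ(σ)`: it is `1 - σ(x+1)` if `x + 1` is a site of `Λ`, and `1` otherwise,
that is, if `x` is the right end point of the interval `Λ` (frozen zero at the site to the
right of `Λ`). For `Λ = ℤ` it is the constraint `1 - σ(x+1)` of the infinite-volume process. -/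
def constraint {Λ : Set ℤ} (x : Λ) (σ : Config Λ) : ℝ :=
  if h : (x : ℤ) + 1 ∈ Λ then 1 - occ σ ⟨(x : ℤ) + 1, h⟩ else 1

/-- The rate `c_x^Λ(σ) [(1 - σ(x)) p + σ(x) q]`, with `p = 1 - q`, of the jump from `σ` to
`σ^x`. -/
def rate (q : unitInterval) {Λ : Set ℤ} (x : Λ) (σ : Config Λ) : ℝ :=
  constraint x σ * ((1 - occ σ x) * (1 - (q : ℝ)) + occ σ x * (q : ℝ))

/-- Local functions: those that depend on finitely many sites. -/
def IsLocal {Λ : Set ℤ} (f : Config Λ → ℝ) : Prop :=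
  ∃ s : Finset Λ, DependsOn f (s : Set Λ)

/-- The action of the East generator on local functions,
`∑_x c_x^Λ(σ) [(1 - σ(x)) p + σ(x) q] (f(σ^x) - f(σ))`. For a local `f` only finitely many
terms differ from zero. -/
def localGenerator (q : unitInterval) {Λ : Set ℤ} (f : Config Λ → ℝ) (σ : Config Λ) : ℝ :=
  ∑ᶠ x : Λ, rate q x σ * (f (flipAt σ x) - f σ)

/-- The graph in `L² × L²` of the East generator restricted to local functions. -/
def localGraph (q : unitInterval) (Λ : Set ℤ) :
    Submodule ℝ (Lp ℝ 2 (productMeasure q Λ) × Lp ℝ 2 (productMeasure q Λ)) :=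
  Submodule.span ℝ {u | ∃ f : Config Λ → ℝ, IsLocal f ∧
    u.1 =ᵐ[productMeasure q Λ] f ∧ u.2 =ᵐ[productMeasure q Λ] localGenerator q f}

/-- The East generator on `Λ`, as an unbounded operator in `L²`: the closure of its restriction to
local functions. -/
def generator (q : unitInterval) (Λ : Set ℤ) :
    Lp ℝ 2 (productMeasure q Λ) →ₗ.[ℝ] Lp ℝ 2 (productMeasure q Λ) :=
  (localGraph q Λ).topologicalClosure.toLinearPMap

/-- The Dirichlet form
`(1/2) ∑_x ∫ c_x^Λ(σ) [(1 - σ(x)) p + σ(x) q] (f(σ^x) - f(σ))² dπ_Λ(σ) ∈ [0, ∞]`. -/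
def dirichletForm (q : unitInterval) {Λ : Set ℤ} (f : Config Λ → ℝ) : ℝ≥0∞ :=
  (1 / 2) * ∑' x : Λ, ∫⁻ σ, ENNReal.ofReal (rate q x σ * (f (flipAt σ x) - f σ) ^ 2)
    ∂productMeasure q Λ

/-- The spectral gap of the East generator on `Λ`: the infimum of `D(f) / Var(f)` over the
functions `f` of the domain of the generator that are not (almost everywhere) constant. -/
def gap (q : unitInterval) (Λ : Set ℤ) : ℝ≥0∞ :=
  ⨅ (f : Lp ℝ 2 (productMeasure q Λ)) (_ : f ∈ (generator q Λ).domain)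
    (_ : ¬ ∃ a : ℝ, f =ᵐ[productMeasure q Λ] fun _ => a),
    dirichletForm q f / evariance f (productMeasure q Λ)

end East

end

/-!
The gap is first shown to be the best constant in the Poincaré inequality for local functions
(`le_gap_iff`): the closure only adds limits in the graph norm, and by reversibility that norm
controls the Dirichlet form. Monotonicity in the set of sites (`gap_anti`) follows at once, because
a local function on `V` is a local function on `Λ ⊇ V` and the constraints of `Λ` are more
restrictive.

*Lower bound on the gap.* Local functions are handled with the operators that average over the
occupation of finitely many sites; these are positive unital maps `P` with
`P (P f * g) = P f * P g`, and all that is needed about conditional variances follows from this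
(`IsAveraging`). Two blocks of about `L` sites with an overlap of `d` sites are put together by
`IsAveraging.opVar_le_two_blocks`: the left block may be resampled only if the overlap contains an
empty site, which costs a factor of order `1 / (1 - (1 - q) ^ d)`, and then it may be enlarged up to
that empty site (`blockAvg_facilitated_le`). With overlaps of length `L / M` the length grows by a
factor `r = 2 - 1 / M` at the cost of `O (1 / (q r ^ k))` in the `k`-th step, so that the length
`1 / q` is reached with the constant `exp (log² (1 / q) / (2 log r) + O (log (1 / q)))`. At that
length a block contains an empty site with high probability, and one application of
`IsAveraging.opVar_apply_le_constrained` to a chain of blocks gives the inequality in infinite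
volume (`opVar_blockAvg_chain`, `le_gap_of_blockPoincare`). Since `M` is arbitrary, the constant is
`1 / (2 log 2)`.

*Upper bound on the gap.* By monotonicity a finite interval of `2 ^ n` sites with an empty site
frozen to its right may be used. The test function is the indicator of the configurations whose
empty sites can be removed one by one, a site among `k` of them being removable if another empty
site, or the frozen one, is at distance at most `2 ^ (n - k)` to its right (`Dismantlable`). The
admissible distance doubles with each removal, so any admissible first removal can be completed
(`Dismantlable.erase`), and a legal flip can leave this set only from a configuration with `n` empty
sites. At most `n! * 2 ^ (n * (n - 1) / 2)` sets of `n` empty sites are dismantlable, and each of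
them is empty with probability `q ^ n`. The variance of the test function is not too small, because
a dismantlable set has no point at distance `2 ^ n`. The choice `2 ^ n ≈ 1 / q` gives the matching
bound.
-/

noncomputable section

namespace East

variable {q : unitInterval} {Λ : Set ℤ}

/-! ### The product measure and single-site flips -/

instance (q : unitInterval) (Λ : Set ℤ) : IsProbabilityMeasure (productMeasure q Λ) := by
  unfold productMeasure; infer_instance

lemma coe_toNNReal_eq_ofReal (r : unitInterval) :
    ((unitInterval.toNNReal r : NNReal) : ℝ≥0∞) = ENNReal.ofReal r := by
  rw [ENNReal.ofReal, Real.toNNReal_of_nonneg r.2.1]; rfl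

open Classical in
/-- Resampling the value at one site does not change the product measure. -/
lemma resample_productMeasure (q : unitInterval) (x : Λ) :
    ENNReal.ofReal (1 - q) • (productMeasure q Λ).map (fun σ => Function.update σ x true) +
      ENNReal.ofReal q • (productMeasure q Λ).map (fun σ => Function.update σ x false) =
    productMeasure q Λ := by
  refine Measure.eq_infinitePi (μ := fun _ : Λ => bernoulliMeasure true false (unitInterval.symm q))
    fun s t ht => ?_
  have hmeas : MeasurableSet (Set.pi (s : Set Λ) t) := .pi s.countable_toSet fun i _ => ht i
  have hupd : ∀ b : Bool, Measurable fun σ : Config Λ => Function.update σ x b := fun b => by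
    fun_prop
  have hb : ∀ i, bernoulliMeasure true false (unitInterval.symm q) (t i) =
      ENNReal.ofReal (1 - q) * (if true ∈ t i then 1 else 0) +
        ENNReal.ofReal q * (if false ∈ t i then 1 else 0) := fun i => by
    rw [bernoulliMeasure_def]
    simp [Measure.add_apply, Measure.smul_apply, Measure.dirac_apply' _ (ht i), Set.indicator,
      coe_toNNReal_eq_ofReal, ENNReal.smul_def]
  rw [Measure.add_apply, Measure.smul_apply, Measure.smul_apply,
    Measure.map_apply (hupd _) hmeas, Measure.map_apply (hupd _) hmeas]
  have hpre : ∀ b : Bool, x ∈ s → (fun σ : Config Λ => Function.update σ x b) ⁻¹' (Set.pi s t) =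
      if b ∈ t x then Set.pi ((s.erase x : Finset Λ) : Set Λ) t else ∅ := fun b hx => by
    ext σ
    split_ifs with h
    · simp only [Set.mem_preimage, Set.mem_pi, Finset.mem_coe, Finset.mem_erase]
      refine ⟨fun H i hi => ?_, fun H i hi => ?_⟩
      · simpa [Function.update_of_ne hi.1] using H i hi.2
      · by_cases hix : i = x
        · subst hix; simpa using h
        · simpa [Function.update_of_ne hix] using H i ⟨hix, hi⟩
    · simp only [Set.mem_preimage, Set.mem_pi, Set.mem_empty_iff_false, iff_false]
      exact fun H => h (by simpa using H x hx)
  by_cases hx : x ∈ s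
  · rw [hpre _ hx, hpre _ hx, ← Finset.mul_prod_erase s _ hx, hb x]
    have hpi := Measure.infinitePi_pi
      (μ := fun _ : Λ => bernoulliMeasure true false (unitInterval.symm q))
      (s := s.erase x) (t := t) fun i _ => ht i
    rw [← hpi]
    by_cases h1 : true ∈ t x <;> by_cases h2 : false ∈ t x <;>
      simp [h1, h2, productMeasure, add_mul]
  · have : ∀ b : Bool, (fun σ : Config Λ => Function.update σ x b) ⁻¹' (Set.pi s t) =
        Set.pi s t := fun b => by
      ext σ
      simp only [Set.mem_preimage, Set.mem_pi]
      refine forall₂_congr fun i hi => ?_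
      rw [Function.update_of_ne (fun h => hx (by simpa [h] using hi))]
    have hq : ENNReal.ofReal (1 - q) + ENNReal.ofReal q = 1 := by
      rw [← ENNReal.ofReal_add (by linarith [q.2.2]) q.2.1]; simp
    rw [this, this, smul_eq_mul, smul_eq_mul, ← add_mul, hq, one_mul]
    exact Measure.infinitePi_pi
      (μ := fun _ : Λ => bernoulliMeasure true false (unitInterval.symm q)) fun i _ => ht i

lemma lintegral_resample (x : Λ) {f : Config Λ → ℝ≥0∞} (hf : Measurable f) :
    ∫⁻ σ, f σ ∂productMeasure q Λ =
      ∫⁻ σ, (ENNReal.ofReal (1 - q) * f (Function.update σ x true) +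
        ENNReal.ofReal q * f (Function.update σ x false)) ∂productMeasure q Λ := by
  have hupd : ∀ b : Bool, Measurable fun σ : Config Λ => Function.update σ x b := fun b => by
    fun_prop
  conv_lhs => rw [← resample_productMeasure q x]
  rw [lintegral_add_measure, lintegral_smul_measure, lintegral_smul_measure,
    lintegral_map hf (hupd _), lintegral_map hf (hupd _), lintegral_add_left (by fun_prop),
    lintegral_const_mul _ (by fun_prop), lintegral_const_mul _ (by fun_prop)]
  rfl

@[fun_prop]
lemma measurable_flipAt (x : Λ) : Measurable fun σ : Config Λ => flipAt σ x := by
  unfold flipAt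
  refine measurable_pi_iff.2 fun y => ?_
  by_cases h : y = x
  · subst h
    simp only [Function.update_self]
    exact (measurable_of_finite Bool.not).comp (measurable_pi_apply y)
  · simp only [Function.update_of_ne h]
    exact measurable_pi_apply y

@[simp] lemma flipAt_flipAt (σ : Config Λ) (x : Λ) : flipAt (flipAt σ x) x = σ := by
  simp [flipAt]

lemma flipAt_update (σ : Config Λ) (x : Λ) (b : Bool) :
    flipAt (Function.update σ x b) x = Function.update σ x (!b) := by
  simp [flipAt]

@[fun_prop]
lemma measurable_occ (x : Λ) : Measurable fun σ : Config Λ => occ σ x := by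
  unfold occ
  exact (measurable_of_finite fun b : Bool => if b = true then (1 : ℝ) else 0).comp
    (measurable_pi_apply x)

@[fun_prop]
lemma measurable_constraint (x : Λ) : Measurable (constraint x) := by
  unfold constraint
  split_ifs
  · exact (measurable_occ _).const_sub _
  · fun_prop

@[fun_prop]
lemma measurable_rate (q : unitInterval) (x : Λ) : Measurable (rate q x) := by
  unfold rate
  have := measurable_occ x
  have := measurable_constraint x
  fun_prop

lemma occ_mem (σ : Config Λ) (x : Λ) : occ σ x = 0 ∨ occ σ x = 1 := by
  unfold occ; split_ifs <;> simp

lemma constraint_mem (x : Λ) (σ : Config Λ) : constraint x σ = 0 ∨ constraint x σ = 1 := by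
  unfold constraint
  split_ifs with h
  · rcases occ_mem σ ⟨_, h⟩ with h | h <;> simp [h]
  · simp

lemma constraint_nonneg (x : Λ) (σ : Config Λ) : 0 ≤ constraint x σ := by
  rcases constraint_mem x σ with h | h <;> simp [h]

lemma rate_nonneg (x : Λ) (σ : Config Λ) : 0 ≤ rate q x σ := by
  have := q.2.1
  have := q.2.2
  refine mul_nonneg (constraint_nonneg x σ) ?_
  rcases occ_mem σ x with h | h <;> rw [h] <;> linarith

lemma rate_le_one (x : Λ) (σ : Config Λ) : rate q x σ ≤ 1 := by
  have := q.2.1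
  have := q.2.2
  unfold rate
  rcases occ_mem σ x with h | h <;> rcases constraint_mem x σ with h' | h' <;> rw [h, h'] <;>
    linarith

lemma abs_rate_le_one (x : Λ) (σ : Config Λ) : |rate q x σ| ≤ 1 := by
  rw [abs_of_nonneg (rate_nonneg x σ)]
  exact rate_le_one x σ

lemma constraint_update (x : Λ) (σ : Config Λ) (b : Bool) :
    constraint x (Function.update σ x b) = constraint x σ := by
  by_cases h : (x : ℤ) + 1 ∈ Λ
  · have : (⟨(x : ℤ) + 1, h⟩ : Λ) ≠ x := fun h' => by
      have := congrArg Subtype.val h'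
      simp at this
    simp [constraint, occ, h, Function.update_of_ne this]
  · simp [constraint, h]

/-- Reversibility of a single flip with respect to the product measure. -/
lemma detailed_balance (x : Λ) {G : Config Λ → Config Λ → ℝ≥0∞}
    (hG : Measurable (Function.uncurry G)) :
    ∫⁻ σ, ENNReal.ofReal (rate q x σ) * G σ (flipAt σ x) ∂productMeasure q Λ =
      ∫⁻ σ, ENNReal.ofReal (rate q x σ) * G (flipAt σ x) σ ∂productMeasure q Λ := by
  have hr := (measurable_rate q x).ennreal_ofReal
  have hF := measurable_flipAt x
  have h1 : Measurable fun σ => ENNReal.ofReal (rate q x σ) * G σ (flipAt σ x) :=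
    hr.mul (hG.comp (measurable_id.prodMk hF))
  have h2 : Measurable fun σ => ENNReal.ofReal (rate q x σ) * G (flipAt σ x) σ :=
    hr.mul (hG.comp (hF.prodMk measurable_id))
  rw [lintegral_resample x h1, lintegral_resample x h2]
  refine lintegral_congr fun σ => ?_
  have hc := constraint_nonneg x σ
  simp only [flipAt_update, rate, constraint_update, occ, Function.update_self, Bool.not_true,
    Bool.not_false, if_true, Bool.false_eq_true, if_false]
  simp only [sub_self, zero_mul, zero_add, one_mul, sub_zero, add_zero, ENNReal.ofReal_mul hc]
  ring

/-- Almost sure equality is preserved by a flip, for `0 < q < 1`. -/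
lemma ae_flipAt (h0 : 0 < q) (h1 : q < 1) (x : Λ) {P : Config Λ → Prop}
    (h : ∀ᵐ σ ∂productMeasure q Λ, P σ) : ∀ᵐ σ ∂productMeasure q Λ, P (flipAt σ x) := by
  obtain ⟨t, hst, htm, ht⟩ := exists_measurable_superset_of_null (ae_iff.1 h)
  have hp : ENNReal.ofReal (1 - q) ≠ 0 := by
    have : (q : ℝ) < 1 := h1
    simpa using this
  have hq : ENNReal.ofReal q ≠ 0 := by
    have : (0 : ℝ) < q := h0
    simpa using this
  have hm : Measurable (t.indicator (1 : Config Λ → ℝ≥0∞)) := measurable_one.indicator htm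
  have e1 : ∫⁻ σ, t.indicator 1 σ ∂productMeasure q Λ = 0 := by
    rw [lintegral_indicator_one htm, ht]
  rw [lintegral_resample x hm, lintegral_eq_zero_iff (by fun_prop)] at e1
  have e2 : ∫⁻ σ, t.indicator 1 (flipAt σ x) ∂productMeasure q Λ = 0 := by
    have hm' : Measurable fun σ => t.indicator (1 : Config Λ → ℝ≥0∞) (flipAt σ x) := by fun_prop
    rw [lintegral_resample x hm', lintegral_eq_zero_iff (by fun_prop)]
    · filter_upwards [e1] with σ hσ
      simp only [Pi.zero_apply, add_eq_zero, mul_eq_zero, hp, hq, false_or] at hσ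
      simp [flipAt_update, hσ.1, hσ.2]
  rw [lintegral_eq_zero_iff (by fun_prop)] at e2
  filter_upwards [e2] with σ hσ
  by_contra hP
  have : flipAt σ x ∈ t := hst hP
  simp [this] at hσ

/-- The contribution of the site `x` to twice the Dirichlet form. -/
def siteEnergy (q : unitInterval) (x : Λ) (f : Config Λ → ℝ) : ℝ≥0∞ :=
  ∫⁻ σ, ENNReal.ofReal (rate q x σ * (f (flipAt σ x) - f σ) ^ 2) ∂productMeasure q Λ

lemma dirichletForm_eq (f : Config Λ → ℝ) :
    dirichletForm q f = (1 / 2) * ∑' x : Λ, siteEnergy q x f := rfl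

lemma siteEnergy_congr (h0 : 0 < q) (h1 : q < 1) (x : Λ) {f g : Config Λ → ℝ}
    (h : f =ᵐ[productMeasure q Λ] g) : siteEnergy q x f = siteEnergy q x g := by
  refine lintegral_congr_ae ?_
  filter_upwards [h, ae_flipAt h0 h1 x h] with σ h h'
  rw [h, h']

lemma dirichletForm_congr (h0 : 0 < q) (h1 : q < 1) {f g : Config Λ → ℝ}
    (h : f =ᵐ[productMeasure q Λ] g) : dirichletForm q f = dirichletForm q g := by
  simp only [dirichletForm_eq, siteEnergy_congr h0 h1 _ h]

lemma add_sq_le_weighted {t : ℝ} (ht : 0 < t) (a b : ℝ) :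
    (a + b) ^ 2 ≤ (1 + t) * a ^ 2 + (1 + t⁻¹) * b ^ 2 := by
  have h : (1 + t) * a ^ 2 + (1 + t⁻¹) * b ^ 2 - (a + b) ^ 2 = t⁻¹ * (t * a - b) ^ 2 := by
    field_simp; ring
  have : 0 ≤ t⁻¹ * (t * a - b) ^ 2 := by positivity
  linarith

lemma siteEnergy_add_le {t : ℝ} (ht : 0 < t) (x : Λ) {f g : Config Λ → ℝ} (hf : Measurable f) :
    siteEnergy q x (f + g) ≤ ENNReal.ofReal (1 + t) * siteEnergy q x f +
      ENNReal.ofReal (1 + t⁻¹) * siteEnergy q x g := by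
  unfold siteEnergy
  have hm : Measurable fun σ => ENNReal.ofReal (rate q x σ * (f (flipAt σ x) - f σ) ^ 2) := by
    fun_prop
  rw [← lintegral_const_mul _ hm, ← lintegral_const_mul' _ _ ENNReal.ofReal_ne_top,
    ← lintegral_add_left (hm.const_mul _)]
  refine lintegral_mono fun σ => ?_
  have hr := rate_nonneg (q := q) x σ
  rw [← ENNReal.ofReal_mul (by positivity), ← ENNReal.ofReal_mul (by positivity),
    ← ENNReal.ofReal_add (by positivity) (by positivity)]
  refine ENNReal.ofReal_le_ofReal ?_
  have := add_sq_le_weighted ht (f (flipAt σ x) - f σ) (g (flipAt σ x) - g σ)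
  calc _ = rate q x σ * ((f (flipAt σ x) - f σ) + (g (flipAt σ x) - g σ)) ^ 2 := by
        simp only [Pi.add_apply]; ring
    _ ≤ rate q x σ * _ := mul_le_mul_of_nonneg_left this hr
    _ = _ := by ring

lemma dirichletForm_add_le {t : ℝ} (ht : 0 < t) {f g : Config Λ → ℝ} (hf : Measurable f) :
    dirichletForm q (f + g) ≤ ENNReal.ofReal (1 + t) * dirichletForm q f +
      ENNReal.ofReal (1 + t⁻¹) * dirichletForm q g := by
  simp only [dirichletForm_eq]
  rw [mul_left_comm (ENNReal.ofReal _), mul_left_comm (ENNReal.ofReal _), ← mul_add]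
  refine mul_le_mul' le_rfl ?_
  rw [← ENNReal.tsum_mul_left, ← ENNReal.tsum_mul_left, ← ENNReal.tsum_add]
  exact ENNReal.tsum_le_tsum fun x => siteEnergy_add_le ht x hf

/-- By reversibility, one site contributes at most `4 ‖f‖²`. -/
lemma siteEnergy_le (x : Λ) {f : Config Λ → ℝ} (hf : Measurable f) :
    siteEnergy q x f ≤ 4 * ∫⁻ σ, ENNReal.ofReal (f σ ^ 2) ∂productMeasure q Λ := by
  have hm : Measurable fun σ => ENNReal.ofReal (f σ ^ 2) := by fun_prop
  have hmF : Measurable fun σ => ENNReal.ofReal (f (flipAt σ x) ^ 2) :=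
    hm.comp (measurable_flipAt x)
  have hr := (measurable_rate q x).ennreal_ofReal
  have hle : ∀ σ, ENNReal.ofReal (rate q x σ) ≤ 1 := fun σ => by
    simpa using rate_le_one (q := q) x σ
  have hA : ∫⁻ σ, ENNReal.ofReal (rate q x σ) * ENNReal.ofReal (f σ ^ 2) ∂productMeasure q Λ ≤
      ∫⁻ σ, ENNReal.ofReal (f σ ^ 2) ∂productMeasure q Λ :=
    lintegral_mono fun σ => mul_le_of_le_one_left' (hle σ)
  have hB := detailed_balance (q := q) x (G := fun σ _ => ENNReal.ofReal (f σ ^ 2))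
    (hm.comp measurable_fst)
  calc siteEnergy q x f
      ≤ ∫⁻ σ, (2 * (ENNReal.ofReal (rate q x σ) * ENNReal.ofReal (f (flipAt σ x) ^ 2)) +
          2 * (ENNReal.ofReal (rate q x σ) * ENNReal.ofReal (f σ ^ 2))) ∂productMeasure q Λ := by
        refine lintegral_mono fun σ => ?_
        have hr := rate_nonneg (q := q) x σ
        rw [← ENNReal.ofReal_mul hr, ← ENNReal.ofReal_mul hr]
        have h2 : (2 : ℝ≥0∞) = ENNReal.ofReal 2 := by simp
        rw [h2, ← ENNReal.ofReal_mul (by norm_num), ← ENNReal.ofReal_mul (by norm_num),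
          ← ENNReal.ofReal_add (by positivity) (by positivity)]
        refine ENNReal.ofReal_le_ofReal ?_
        nlinarith [mul_nonneg hr (sq_nonneg (f (flipAt σ x) + f σ))]
    _ = 2 * ∫⁻ σ, ENNReal.ofReal (rate q x σ) * ENNReal.ofReal (f σ ^ 2) ∂productMeasure q Λ +
        2 * ∫⁻ σ, ENNReal.ofReal (rate q x σ) * ENNReal.ofReal (f σ ^ 2) ∂productMeasure q Λ := by
        rw [lintegral_add_left (by fun_prop), lintegral_const_mul _ (by fun_prop),
          lintegral_const_mul _ (by fun_prop), ← hB]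
    _ ≤ _ := by
        rw [← add_mul]
        norm_num
        gcongr

/-! ### The gap as a Poincaré constant of local functions -/

lemma integral_resample (x : Λ) {f : Config Λ → ℝ} (hf : Measurable f) {C : ℝ}
    (hC : ∀ σ, |f σ| ≤ C) :
    ∫ σ, f σ ∂productMeasure q Λ =
      ∫ σ, ((1 - q) * f (Function.update σ x true) +
        q * f (Function.update σ x false)) ∂productMeasure q Λ := by
  have hupd : ∀ b : Bool, Measurable fun σ : Config Λ => Function.update σ x b := fun b => by
    fun_prop
  have hint : ∀ b : Bool, Integrable (fun σ => f (Function.update σ x b)) (productMeasure q Λ) :=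
    fun b => .of_bound (hf.comp (hupd b)).aestronglyMeasurable C (.of_forall fun σ => hC _)
  have hmap : ∀ b : Bool, Integrable f
      ((productMeasure q Λ).map fun σ => Function.update σ x b) := fun b => by
    rw [integrable_map_measure hf.aestronglyMeasurable (hupd b).aemeasurable]
    exact hint b
  conv_lhs => rw [← resample_productMeasure q x]
  rw [integral_add_measure ((hmap _).smul_measure ENNReal.ofReal_ne_top)
    ((hmap _).smul_measure ENNReal.ofReal_ne_top), integral_smul_measure, integral_smul_measure,
    integral_map (hupd _).aemeasurable hf.aestronglyMeasurable,
    integral_map (hupd _).aemeasurable hf.aestronglyMeasurable,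
    integral_add ((hint _).const_mul _) ((hint _).const_mul _), integral_const_mul,
    integral_const_mul, ENNReal.toReal_ofReal (by linarith [q.2.2]), ENNReal.toReal_ofReal q.2.1]
  rfl

/-- A local function factors through a finite set of configurations. -/
lemma IsLocal.exists_factor {f : Config Λ → ℝ} (hf : IsLocal f) :
    ∃ (s : Finset Λ) (g : (s → Bool) → ℝ), ∀ σ, f σ = g (s.restrict σ) := by
  classical
  obtain ⟨s, hs⟩ := hf
  refine ⟨s, fun τ => f fun i => if h : i ∈ s then τ ⟨i, h⟩ else false, fun σ => hs fun i hi => ?_⟩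
  simp [Finset.mem_coe.1 hi]

lemma IsLocal.measurable {f : Config Λ → ℝ} (hf : IsLocal f) : Measurable f := by
  obtain ⟨s, g, hg⟩ := hf.exists_factor
  rw [funext hg]
  exact (measurable_of_finite g).comp (Finset.measurable_restrict s)

lemma IsLocal.bounded {f : Config Λ → ℝ} (hf : IsLocal f) : ∃ C, ∀ σ, |f σ| ≤ C := by
  obtain ⟨s, g, hg⟩ := hf.exists_factor
  exact ⟨∑ τ, |g τ|, fun σ => hg σ ▸
    Finset.single_le_sum (f := fun τ => |g τ|) (fun _ _ => abs_nonneg _) (Finset.mem_univ _)⟩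

lemma IsLocal.memLp {f : Config Λ → ℝ} (hf : IsLocal f) (r : ℝ≥0∞) :
    MemLp f r (productMeasure q Λ) := by
  obtain ⟨C, hC⟩ := hf.bounded
  exact .of_bound hf.measurable.aestronglyMeasurable C (.of_forall hC)

lemma IsLocal.add {f g : Config Λ → ℝ} (hf : IsLocal f) (hg : IsLocal g) : IsLocal (f + g) := by
  classical
  obtain ⟨s, hs⟩ := hf
  obtain ⟨t, ht⟩ := hg
  refine ⟨s ∪ t, fun σ τ h => ?_⟩
  rw [Pi.add_apply, Pi.add_apply, hs fun i hi => h i (by simp_all),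
    ht fun i hi => h i (by simp_all)]

lemma IsLocal.smul {f : Config Λ → ℝ} (hf : IsLocal f) (a : ℝ) : IsLocal (a • f) := by
  obtain ⟨s, hs⟩ := hf
  exact ⟨s, fun σ τ h => by rw [Pi.smul_apply, Pi.smul_apply, hs h]⟩

lemma apply_flipAt_of_notMem {f : Config Λ → ℝ} {s : Set Λ} (hs : DependsOn f s) {x : Λ}
    (hx : x ∉ s) (σ : Config Λ) : f (flipAt σ x) = f σ :=
  hs fun i hi => by
    unfold flipAt
    rw [Function.update_of_ne fun h : i = x => hx (h ▸ hi)]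

lemma localGenerator_support_subset {f : Config Λ → ℝ} {s : Finset Λ}
    (hs : DependsOn f (s : Set Λ)) (σ : Config Λ) :
    Function.support (fun x : Λ => rate q x σ * (f (flipAt σ x) - f σ)) ⊆ s := by
  intro x hx
  by_contra h
  exact hx (by simp [apply_flipAt_of_notMem hs h])

lemma localGenerator_eq_sum {f : Config Λ → ℝ} {s : Finset Λ} (hs : DependsOn f (s : Set Λ))
    (σ : Config Λ) :
    localGenerator q f σ = ∑ x ∈ s, rate q x σ * (f (flipAt σ x) - f σ) :=
  finsum_eq_sum_of_support_subset _ (localGenerator_support_subset hs σ)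

lemma localGenerator_add {f g : Config Λ → ℝ} (hf : IsLocal f) (hg : IsLocal g) :
    localGenerator q (f + g) = localGenerator q f + localGenerator q g := by
  obtain ⟨s, hs⟩ := hf
  obtain ⟨t, ht⟩ := hg
  funext σ
  rw [Pi.add_apply]
  unfold localGenerator
  rw [← finsum_add_distrib (s.finite_toSet.subset (localGenerator_support_subset hs σ))
    (t.finite_toSet.subset (localGenerator_support_subset ht σ))]
  refine finsum_congr fun x => ?_
  simp only [Pi.add_apply]
  ring

lemma localGenerator_smul (f : Config Λ → ℝ) (a : ℝ) :
    localGenerator q (a • f) = a • localGenerator q f := by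
  funext σ
  rw [Pi.smul_apply]
  unfold localGenerator
  rw [smul_finsum]
  refine finsum_congr fun x => ?_
  simp only [Pi.smul_apply, smul_eq_mul]
  ring

lemma mem_localGraph_iff {u : Lp ℝ 2 (productMeasure q Λ) × Lp ℝ 2 (productMeasure q Λ)} :
    u ∈ localGraph q Λ ↔ ∃ f : Config Λ → ℝ, IsLocal f ∧
      u.1 =ᵐ[productMeasure q Λ] f ∧ u.2 =ᵐ[productMeasure q Λ] localGenerator q f := by
  refine ⟨fun hu => ?_, fun hu => Submodule.subset_span hu⟩
  unfold localGraph at hu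
  induction hu using Submodule.span_induction with
  | mem u hu => exact hu
  | zero =>
    refine ⟨0, ⟨∅, fun _ _ _ => rfl⟩, Lp.coeFn_zero _ _ _, ?_⟩
    have : localGenerator q (0 : Config Λ → ℝ) = 0 := by
      funext σ; simp [localGenerator]
    rw [this]
    exact Lp.coeFn_zero _ _ _
  | add u v _ _ hu hv =>
    obtain ⟨f, hf, hf1, hf2⟩ := hu
    obtain ⟨g, hg, hg1, hg2⟩ := hv
    refine ⟨f + g, hf.add hg, (Lp.coeFn_add _ _).trans (hf1.add hg1), ?_⟩
    rw [localGenerator_add hf hg]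
    exact (Lp.coeFn_add _ _).trans (hf2.add hg2)
  | smul a u _ hu =>
    obtain ⟨f, hf, hf1, hf2⟩ := hu
    refine ⟨a • f, hf.smul a, (Lp.coeFn_smul _ _).trans (hf1.const_smul a), ?_⟩
    rw [localGenerator_smul]
    exact (Lp.coeFn_smul _ _).trans (hf2.const_smul a)

/-- Summation by parts at one site. -/
lemma integral_mul_flip_sub (x : Λ) {f : Config Λ → ℝ} (hf : IsLocal f) :
    ∫ σ, f σ * (rate q x σ * (f (flipAt σ x) - f σ)) ∂productMeasure q Λ =
      -(1 / 2) * ∫ σ, rate q x σ * (f (flipAt σ x) - f σ) ^ 2 ∂productMeasure q Λ := by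
  obtain ⟨C, hC⟩ := hf.bounded
  have hm := hf.measurable
  have hr : ∀ σ, |rate q x σ| ≤ 1 := abs_rate_le_one x
  have hd : ∀ σ, |f (flipAt σ x) - f σ| ≤ C + C := fun σ =>
    (abs_sub _ _).trans (add_le_add (hC _) (hC _))
  have hi1 : Integrable (fun σ => f σ * (rate q x σ * (f (flipAt σ x) - f σ)))
      (productMeasure q Λ) := by
    refine .of_bound (by fun_prop) (C * (1 * (C + C))) (.of_forall fun σ => ?_)
    rw [Real.norm_eq_abs, abs_mul, abs_mul]
    have := (abs_nonneg _).trans (hC σ)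
    gcongr
    exacts [hC σ, hr σ, hd σ]
  have hi2 : Integrable (fun σ => rate q x σ * (f (flipAt σ x) - f σ) ^ 2)
      (productMeasure q Λ) := by
    refine .of_bound (by fun_prop) (1 * (C + C) ^ 2) (.of_forall fun σ => ?_)
    rw [Real.norm_eq_abs, abs_mul, abs_pow]
    gcongr
    exacts [hr σ, hd σ]
  rw [← sub_eq_zero, ← integral_const_mul, ← integral_sub hi1 (hi2.const_mul _),
    integral_resample (C := C * (1 * (C + C)) + 1 / 2 * (1 * (C + C) ^ 2)) x (by fun_prop)]
  · refine integral_eq_zero_of_ae (.of_forall fun σ => ?_)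
    simp only [flipAt_update, rate, constraint_update, occ, Function.update_self, Bool.not_true,
      Bool.not_false, if_true, Bool.false_eq_true, if_false, Pi.zero_apply]
    ring
  · intro σ
    refine (abs_sub _ _).trans (add_le_add ?_ ?_)
    · rw [abs_mul, abs_mul]
      have := (abs_nonneg _).trans (hC σ)
      gcongr
      exacts [hC σ, hr σ, hd σ]
    · rw [abs_mul, abs_mul, abs_pow]
      gcongr
      · norm_num [abs_of_nonneg]
      exacts [hr σ, hd σ]

lemma IsLocal.siteEnergy_eq (x : Λ) {f : Config Λ → ℝ} (hf : IsLocal f) :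
    siteEnergy q x f =
      ENNReal.ofReal (∫ σ, rate q x σ * (f (flipAt σ x) - f σ) ^ 2 ∂productMeasure q Λ) := by
  obtain ⟨C, hC⟩ := hf.bounded
  have hm := hf.measurable
  have hr : ∀ σ, |rate q x σ| ≤ 1 := abs_rate_le_one x
  rw [siteEnergy, ofReal_integral_eq_lintegral_ofReal]
  · refine .of_bound (by fun_prop) (1 * (C + C) ^ 2) (.of_forall fun σ => ?_)
    rw [Real.norm_eq_abs, abs_mul, abs_pow]
    gcongr
    exacts [hr σ, (abs_sub _ _).trans (add_le_add (hC _) (hC _))]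
  · exact .of_forall fun σ => mul_nonneg (rate_nonneg x σ) (sq_nonneg _)

lemma dirichletForm_eq_sum {f : Config Λ → ℝ} {s : Finset Λ}
    (hs : DependsOn f (s : Set Λ)) :
    dirichletForm q f = (1 / 2) * ∑ x ∈ s, siteEnergy q x f := by
  rw [dirichletForm_eq, tsum_eq_sum fun x hx => ?_]
  have : ∀ σ, f (flipAt σ x) = f σ := apply_flipAt_of_notMem hs hx
  simp [siteEnergy, this]

/-- The Dirichlet form is the quadratic form of the generator on local functions. -/
lemma IsLocal.dirichletForm_eq {f : Config Λ → ℝ} (hf : IsLocal f) :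
    dirichletForm q f =
      ENNReal.ofReal (-∫ σ, f σ * localGenerator q f σ ∂productMeasure q Λ) := by
  obtain ⟨s, hs⟩ := id hf
  obtain ⟨C, hC⟩ := hf.bounded
  have hm := hf.measurable
  have hr : ∀ (x : Λ) σ, |rate q x σ| ≤ 1 := abs_rate_le_one
  have hi : ∀ x ∈ s, Integrable (fun σ => f σ * (rate q x σ * (f (flipAt σ x) - f σ)))
      (productMeasure q Λ) := fun x _ => by
    refine .of_bound (by fun_prop) (C * (1 * (C + C))) (.of_forall fun σ => ?_)
    rw [Real.norm_eq_abs, abs_mul, abs_mul]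
    have := (abs_nonneg _).trans (hC σ)
    gcongr
    exacts [hC σ, hr x σ, (abs_sub _ _).trans (add_le_add (hC _) (hC _))]
  simp only [localGenerator_eq_sum hs, Finset.mul_sum]
  rw [integral_finsetSum _ hi, dirichletForm_eq_sum hs, Finset.mul_sum, ← Finset.sum_neg_distrib,
    ENNReal.ofReal_sum_of_nonneg]
  · refine Finset.sum_congr rfl fun x _ => ?_
    rw [integral_mul_flip_sub x hf, hf.siteEnergy_eq, neg_mul, neg_neg,
      ENNReal.ofReal_mul (by norm_num)]
    congr 1
    rw [ENNReal.ofReal_div_of_pos (by norm_num)]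
    simp
  · intro x _
    rw [integral_mul_flip_sub x hf, neg_mul, neg_neg]
    exact mul_nonneg (by norm_num)
      (integral_nonneg fun σ => mul_nonneg (rate_nonneg x σ) (sq_nonneg _))

lemma dirichletForm_le_of_mem_localGraph (h0 : 0 < q) (h1 : q < 1)
    {u : Lp ℝ 2 (productMeasure q Λ) × Lp ℝ 2 (productMeasure q Λ)} (hu : u ∈ localGraph q Λ) :
    dirichletForm q u.1 ≤ ENNReal.ofReal (‖u‖ ^ 2) := by
  obtain ⟨f, hf, hf1, hf2⟩ := mem_localGraph_iff.1 hu
  rw [dirichletForm_congr h0 h1 hf1, hf.dirichletForm_eq]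
  refine ENNReal.ofReal_le_ofReal ?_
  have : ∫ σ, f σ * localGenerator q f σ ∂productMeasure q Λ = inner ℝ u.1 u.2 := by
    rw [L2.inner_def]
    refine integral_congr_ae ?_
    filter_upwards [hf1, hf2] with σ h h'
    simp [h, h', mul_comm]
  rw [this]
  calc -inner ℝ u.1 u.2 ≤ ‖u.1‖ * ‖u.2‖ := (neg_le_abs _).trans (abs_real_inner_le_norm _ _)
    _ ≤ ‖u‖ * ‖u‖ := by
      gcongr
      exacts [norm_fst_le u, norm_snd_le u]
    _ = _ := (sq _).symm

lemma lintegral_sq_eq_norm (f : Lp ℝ 2 (productMeasure q Λ)) :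
    ∫⁻ σ, ENNReal.ofReal (f σ ^ 2) ∂productMeasure q Λ = ENNReal.ofReal (‖f‖ ^ 2) := by
  rw [← real_inner_self_eq_norm_sq, L2.inner_def, ofReal_integral_eq_lintegral_ofReal]
  · refine lintegral_congr fun σ => ?_
    simp [sq]
  · exact L2.integrable_inner f f
  · exact .of_forall fun σ => real_inner_self_nonneg

/-- The graph norm controls the Dirichlet form on the closure of the graph. -/
lemma dirichletForm_le_of_mem_closure (h0 : 0 < q) (h1 : q < 1)
    {u : Lp ℝ 2 (productMeasure q Λ) × Lp ℝ 2 (productMeasure q Λ)}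
    (hu : u ∈ (localGraph q Λ).topologicalClosure) :
    dirichletForm q u.1 ≤ 2 * ENNReal.ofReal (‖u‖ ^ 2) := by
  obtain ⟨v, hv, hvu⟩ := mem_closure_iff_seq_limit.1 hu
  -- each single site is continuous in `L²`, so finitely many of them pass to the limit
  have key : ∀ s : Finset Λ, ∑ x ∈ s, siteEnergy q x u.1 ≤ 4 * ENNReal.ofReal (‖u‖ ^ 2) := by
    intro s
    have hn : ∀ n, ∑ x ∈ s, siteEnergy q x u.1 ≤
        4 * ENNReal.ofReal (‖v n‖ ^ 2) + s.card * (8 * ENNReal.ofReal (‖u - v n‖ ^ 2)) := by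
      intro n
      have hD := dirichletForm_le_of_mem_localGraph h0 h1 (hv n)
      have hs : ∑ x ∈ s, siteEnergy q x (v n).1 ≤ 2 * ENNReal.ofReal (‖v n‖ ^ 2) := by
        calc _ ≤ ∑' x, siteEnergy q x (v n).1 := ENNReal.sum_le_tsum s
          _ = 2 * dirichletForm q (v n).1 := by
            rw [East.dirichletForm_eq, ← mul_assoc, one_div,
              ENNReal.mul_inv_cancel (by norm_num) (by norm_num), one_mul]
          _ ≤ _ := by gcongr
      have hx : ∀ x ∈ s, siteEnergy q x u.1 ≤
          2 * siteEnergy q x (v n).1 + 8 * ENNReal.ofReal (‖u - v n‖ ^ 2) := by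
        intro x _
        have e : (u.1 : Config Λ → ℝ) =ᵐ[productMeasure q Λ]
            ((v n).1 : Config Λ → ℝ) + ((u - v n).1 : Config Λ → ℝ) := by
          filter_upwards [Lp.coeFn_sub u.1 (v n).1] with σ h
          rw [Pi.add_apply, Prod.fst_sub, h]
          simp
        rw [siteEnergy_congr h0 h1 x e]
        refine (siteEnergy_add_le one_pos x (Lp.stronglyMeasurable _).measurable).trans ?_
        have h8 : siteEnergy q x ((u - v n).1 : Config Λ → ℝ) ≤
            4 * ENNReal.ofReal (‖u - v n‖ ^ 2) := by
          refine (siteEnergy_le x (Lp.stronglyMeasurable _).measurable).trans ?_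
          rw [lintegral_sq_eq_norm]
          gcongr
          exact norm_fst_le _
        have e2 : ENNReal.ofReal (1 + 1) = 2 := by norm_num
        have e2' : ENNReal.ofReal (1 + 1⁻¹) = 2 := by norm_num
        rw [e2, e2']
        calc _ ≤ 2 * siteEnergy q x (v n).1 + 2 * (4 * ENNReal.ofReal (‖u - v n‖ ^ 2)) := by
              gcongr
          _ = _ := by rw [← mul_assoc]; norm_num
      calc _ ≤ ∑ x ∈ s, (2 * siteEnergy q x (v n).1 + 8 * ENNReal.ofReal (‖u - v n‖ ^ 2)) :=
            Finset.sum_le_sum hx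
        _ = 2 * ∑ x ∈ s, siteEnergy q x (v n).1 +
            s.card * (8 * ENNReal.ofReal (‖u - v n‖ ^ 2)) := by
          rw [Finset.sum_add_distrib, ← Finset.mul_sum, Finset.sum_const, nsmul_eq_mul]
        _ ≤ 2 * (2 * ENNReal.ofReal (‖v n‖ ^ 2)) +
            s.card * (8 * ENNReal.ofReal (‖u - v n‖ ^ 2)) := by gcongr
        _ = _ := by rw [← mul_assoc]; norm_num
    have t1 : Tendsto (fun n => ENNReal.ofReal (‖v n‖ ^ 2)) atTop
        (𝓝 (ENNReal.ofReal (‖u‖ ^ 2))) :=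
      ENNReal.tendsto_ofReal ((hvu.norm).pow 2)
    have t2 : Tendsto (fun n => ENNReal.ofReal (‖u - v n‖ ^ 2)) atTop (𝓝 0) := by
      have : Tendsto (fun n => ‖u - v n‖ ^ 2) atTop (𝓝 0) := by
        simpa using ((tendsto_const_nhds (x := u)).sub hvu).norm.pow 2
      simpa using ENNReal.tendsto_ofReal this
    have t3 := (ENNReal.Tendsto.const_mul (a := 4) t1 (Or.inr (by norm_num))).add
      (ENNReal.Tendsto.const_mul (a := (s.card : ℝ≥0∞))
        (ENNReal.Tendsto.const_mul (a := 8) t2 (Or.inr (by norm_num))) (Or.inr (by simp)))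
    simp only [mul_zero, add_zero] at t3
    exact ge_of_tendsto' t3 hn
  rw [East.dirichletForm_eq, ENNReal.tsum_eq_iSup_sum]
  calc _ ≤ (1 / 2 : ℝ≥0∞) * (4 * ENNReal.ofReal (‖u‖ ^ 2)) := by
        gcongr
        exact iSup_le key
    _ = _ := by
      rw [← mul_assoc]
      congr 1
      rw [show (4 : ℝ≥0∞) = 2 * 2 by norm_num, ← mul_assoc, one_div,
        ENNReal.inv_mul_cancel (by norm_num) (by norm_num), one_mul]

lemma evariance_add_le {Ω : Type*} [MeasurableSpace Ω] {μ : Measure Ω} {f g : Ω → ℝ}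
    (hf : Measurable f) (hfi : Integrable f μ) (hgi : Integrable g μ) {t : ℝ} (ht : 0 < t) :
    evariance (f + g) μ ≤
      ENNReal.ofReal (1 + t) * evariance f μ + ENNReal.ofReal (1 + t⁻¹) * evariance g μ := by
  rw [evariance_eq_lintegral_ofReal, evariance_eq_lintegral_ofReal, evariance_eq_lintegral_ofReal,
    ← lintegral_const_mul _ (by fun_prop), ← lintegral_const_mul' _ _ ENNReal.ofReal_ne_top,
    ← lintegral_add_left (by fun_prop)]
  refine lintegral_mono fun ω => ?_
  rw [← ENNReal.ofReal_mul (by positivity), ← ENNReal.ofReal_mul (by positivity),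
    ← ENNReal.ofReal_add (by positivity) (by positivity)]
  refine ENNReal.ofReal_le_ofReal ?_
  have h : ∫ ω, (f + g) ω ∂μ = ∫ ω, f ω ∂μ + ∫ ω, g ω ∂μ := integral_add hfi hgi
  rw [h]
  refine le_trans (le_of_eq ?_) (add_sq_le_weighted ht _ _)
  simp only [Pi.add_apply]
  ring

lemma evariance_le_norm_sq (f : Lp ℝ 2 (productMeasure q Λ)) :
    evariance f (productMeasure q Λ) ≤ ENNReal.ofReal (‖f‖ ^ 2) := by
  have hf := Lp.memLp f
  rw [← ofReal_variance hf]
  refine ENNReal.ofReal_le_ofReal ((variance_le_expectation_sq hf.1).trans (le_of_eq ?_))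
  rw [← real_inner_self_eq_norm_sq, L2.inner_def]
  refine integral_congr_ae (.of_forall fun σ => ?_)
  simp [sq]

/-- A Poincaré inequality for local functions extends to the domain of the generator. -/
lemma mul_evariance_le_of_mem_closure (h0 : 0 < q) (h1 : q < 1) {γ : ℝ≥0∞} (hγ : γ ≠ ⊤)
    (h : ∀ f : Config Λ → ℝ, IsLocal f →
      γ * evariance f (productMeasure q Λ) ≤ dirichletForm q f)
    {u : Lp ℝ 2 (productMeasure q Λ) × Lp ℝ 2 (productMeasure q Λ)}
    (hu : u ∈ (localGraph q Λ).topologicalClosure) :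
    γ * evariance u.1 (productMeasure q Λ) ≤ dirichletForm q u.1 := by
  have hDu := dirichletForm_le_of_mem_closure h0 h1 hu
  obtain ⟨v, hv, hvu⟩ := mem_closure_iff_seq_limit.1 hu
  have hint : ∀ f : Lp ℝ 2 (productMeasure q Λ), Integrable f (productMeasure q Λ) := fun f =>
    (Lp.memLp f).integrable (by norm_num)
  have hms : ∀ f : Lp ℝ 2 (productMeasure q Λ), Measurable f := fun f =>
    (Lp.stronglyMeasurable f).measurable
  -- the weight `t` splits off the error of the approximation; it tends to `0` at the end
  have key : ∀ t : ℝ, 0 < t → γ * evariance u.1 (productMeasure q Λ) ≤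
      ENNReal.ofReal ((1 + t) ^ 2) * dirichletForm q u.1 := by
    intro t ht
    set K := ENNReal.ofReal (1 + t) * (ENNReal.ofReal (1 + t⁻¹) * 2) +
      γ * ENNReal.ofReal (1 + t⁻¹) with hK
    have hn : ∀ n, γ * evariance u.1 (productMeasure q Λ) ≤
        ENNReal.ofReal ((1 + t) ^ 2) * dirichletForm q u.1 +
          K * ENNReal.ofReal (‖u - v n‖ ^ 2) := by
      intro n
      obtain ⟨f, hf, hf1, -⟩ := mem_localGraph_iff.1 (hv n)
      have hloc : γ * evariance (v n).1 (productMeasure q Λ) ≤ dirichletForm q (v n).1 := by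
        rw [evariance_congr hf1, dirichletForm_congr h0 h1 hf1]
        exact h f hf
      have e : (u.1 : Config Λ → ℝ) =ᵐ[productMeasure q Λ]
          ((v n).1 : Config Λ → ℝ) + ((u - v n).1 : Config Λ → ℝ) := by
        filter_upwards [Lp.coeFn_sub u.1 (v n).1] with σ h
        rw [Pi.add_apply, Prod.fst_sub, h]
        simp
      have e' : ((v n).1 : Config Λ → ℝ) =ᵐ[productMeasure q Λ]
          (u.1 : Config Λ → ℝ) + ((v n - u).1 : Config Λ → ℝ) := by
        filter_upwards [Lp.coeFn_sub (v n).1 u.1] with σ h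
        rw [Pi.add_apply, Prod.fst_sub, h]
        simp
      have hD' : dirichletForm q ((v n - u).1 : Config Λ → ℝ) ≤
          2 * ENNReal.ofReal (‖u - v n‖ ^ 2) := by
        rw [← norm_neg (u - v n), neg_sub]
        exact dirichletForm_le_of_mem_closure h0 h1
          (Submodule.sub_mem _ (Submodule.le_topologicalClosure _ (hv n)) hu)
      have hV' : evariance ((u - v n).1 : Config Λ → ℝ) (productMeasure q Λ) ≤
          ENNReal.ofReal (‖u - v n‖ ^ 2) :=
        (evariance_le_norm_sq _).trans (ENNReal.ofReal_le_ofReal (by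
          gcongr; exact norm_fst_le _))
      have hDv : dirichletForm q (v n).1 ≤ ENNReal.ofReal (1 + t) * dirichletForm q u.1 +
          ENNReal.ofReal (1 + t⁻¹) * (2 * ENNReal.ofReal (‖u - v n‖ ^ 2)) := by
        rw [dirichletForm_congr h0 h1 e']
        refine (dirichletForm_add_le ht (hms _)).trans ?_
        gcongr
      calc γ * evariance u.1 (productMeasure q Λ)
          ≤ γ * (ENNReal.ofReal (1 + t) * evariance (v n).1 (productMeasure q Λ) +
              ENNReal.ofReal (1 + t⁻¹) * ENNReal.ofReal (‖u - v n‖ ^ 2)) := by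
            rw [evariance_congr e]
            gcongr
            refine (evariance_add_le (hms _) (hint _) (hint _) ht).trans ?_
            gcongr
        _ = ENNReal.ofReal (1 + t) * (γ * evariance (v n).1 (productMeasure q Λ)) +
              γ * ENNReal.ofReal (1 + t⁻¹) * ENNReal.ofReal (‖u - v n‖ ^ 2) := by ring
        _ ≤ ENNReal.ofReal (1 + t) * (ENNReal.ofReal (1 + t) * dirichletForm q u.1 +
              ENNReal.ofReal (1 + t⁻¹) * (2 * ENNReal.ofReal (‖u - v n‖ ^ 2))) +
              γ * ENNReal.ofReal (1 + t⁻¹) * ENNReal.ofReal (‖u - v n‖ ^ 2) := by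
            gcongr
            exact hloc.trans hDv
        _ = _ := by
            rw [hK, ENNReal.ofReal_pow (p := 1 + t) (by positivity)]
            ring
    have hKt : K ≠ ⊤ := by
      rw [hK]
      exact ENNReal.add_ne_top.2 ⟨ENNReal.mul_ne_top ENNReal.ofReal_ne_top
        (ENNReal.mul_ne_top ENNReal.ofReal_ne_top (by norm_num)),
        ENNReal.mul_ne_top hγ ENNReal.ofReal_ne_top⟩
    have t2 : Tendsto (fun n => ENNReal.ofReal (‖u - v n‖ ^ 2)) atTop (𝓝 0) := by
      have : Tendsto (fun n => ‖u - v n‖ ^ 2) atTop (𝓝 0) := by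
        simpa using ((tendsto_const_nhds (x := u)).sub hvu).norm.pow 2
      simpa using ENNReal.tendsto_ofReal this
    have t3 := (tendsto_const_nhds
      (x := ENNReal.ofReal ((1 + t) ^ 2) * dirichletForm q u.1)).add
      (ENNReal.Tendsto.const_mul t2 (Or.inr hKt))
    rw [mul_zero, add_zero] at t3
    exact ge_of_tendsto' t3 hn
  have hlim : Tendsto (fun t : ℝ => ENNReal.ofReal ((1 + t) ^ 2) * dirichletForm q u.1)
      (𝓝[>] 0) (𝓝 (ENNReal.ofReal ((1 + 0) ^ 2) * dirichletForm q u.1)) := by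
    refine ENNReal.Tendsto.mul_const (ENNReal.tendsto_ofReal ?_) (Or.inr ?_)
    · have : Continuous fun t : ℝ => (1 + t) ^ 2 := by fun_prop
      exact (this.tendsto 0).mono_left nhdsWithin_le_nhds
    · exact ne_top_of_le_ne_top (ENNReal.mul_ne_top (by norm_num) ENNReal.ofReal_ne_top) hDu
  simp only [add_zero, one_pow, ENNReal.ofReal_one, one_mul] at hlim
  exact ge_of_tendsto hlim (eventually_mem_nhdsWithin.mono fun t ht => key t ht)

/-- The spectral gap is the best constant in the Poincaré inequality for local functions. -/
theorem le_gap_iff (h0 : 0 < q) (h1 : q < 1) {γ : ℝ≥0∞} (hγ : γ ≠ ⊤) :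
    γ ≤ gap q Λ ↔ ∀ f : Config Λ → ℝ, IsLocal f →
      γ * evariance f (productMeasure q Λ) ≤ dirichletForm q f := by
  have hdom : ∀ f : Lp ℝ 2 (productMeasure q Λ), f ∈ (generator q Λ).domain ↔
      ∃ u ∈ (localGraph q Λ).topologicalClosure, u.1 = f := fun f => by
    rw [generator, Submodule.toLinearPMap_domain, Submodule.mem_map]
    rfl
  have hvar : ∀ f : Lp ℝ 2 (productMeasure q Λ), evariance f (productMeasure q Λ) ≠ ⊤ := fun f =>
    evariance_ne_top (Lp.memLp f)
  have hconst : ∀ f : Lp ℝ 2 (productMeasure q Λ), (¬ ∃ a : ℝ, f =ᵐ[productMeasure q Λ] fun _ => a) →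
      evariance f (productMeasure q Λ) ≠ 0 := fun f hf hv =>
    hf ⟨_, (evariance_eq_zero_iff (Lp.stronglyMeasurable f).measurable.aemeasurable).1 hv⟩
  unfold gap
  simp only [le_iInf_iff]
  refine ⟨fun H f hf => ?_, fun H f hf hc => ?_⟩
  · have hm : MemLp f 2 (productMeasure q Λ) := hf.memLp 2
    have hL : MemLp (localGenerator q f) 2 (productMeasure q Λ) := by
      obtain ⟨s, hs⟩ := id hf
      obtain ⟨C, hC⟩ := hf.bounded
      have hmf := hf.measurable
      rw [funext (localGenerator_eq_sum (q := q) hs)]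
      refine memLp_finsetSum _ fun x _ => ?_
      refine .of_bound (by fun_prop) (1 * (C + C)) (.of_forall fun σ => ?_)
      rw [Real.norm_eq_abs, abs_mul]
      gcongr
      exacts [abs_rate_le_one x σ,
        (abs_sub _ _).trans (add_le_add (hC _) (hC _))]
    by_cases hc : ∃ a : ℝ, hm.toLp f =ᵐ[productMeasure q Λ] fun _ => a
    · obtain ⟨a, ha⟩ := hc
      have : f =ᵐ[productMeasure q Λ] fun _ => a := hm.coeFn_toLp.symm.trans ha
      have hv : evariance f (productMeasure q Λ) = 0 := by
        rw [evariance_eq_zero_iff hf.measurable.aemeasurable, integral_congr_ae this]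
        simpa using this
      simp [hv]
    · have hmem : hm.toLp f ∈ (generator q Λ).domain := (hdom _).2
        ⟨(hm.toLp f, hL.toLp _), Submodule.le_topologicalClosure _
          (mem_localGraph_iff.2 ⟨f, hf, hm.coeFn_toLp, hL.coeFn_toLp⟩), rfl⟩
      have := H _ hmem hc
      rwa [ENNReal.le_div_iff_mul_le (Or.inl (hconst _ hc)) (Or.inl (hvar _)),
        evariance_congr hm.coeFn_toLp, dirichletForm_congr h0 h1 hm.coeFn_toLp] at this
  · obtain ⟨u, hu, rfl⟩ := (hdom f).1 hf
    rw [ENNReal.le_div_iff_mul_le (Or.inl (hconst _ hc)) (Or.inl (hvar _))]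
    exact mul_evariance_le_of_mem_closure h0 h1 hγ H hu

/-- Restriction of configurations to a smaller set of sites. -/
def restrictConfig {V Λ : Set ℤ} (h : V ⊆ Λ) (σ : Config Λ) : Config V :=
  fun x => σ ⟨x, h x.2⟩

lemma measurePreserving_restrictConfig {V Λ : Set ℤ} (h : V ⊆ Λ) :
    MeasurePreserving (restrictConfig h) (productMeasure q Λ) (productMeasure q V) := by
  have hm : Measurable (restrictConfig h) :=
    measurable_pi_iff.2 fun x => measurable_pi_apply _
  refine ⟨hm, Measure.eq_infinitePi (μ := fun _ : V => bernoulliMeasure true false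
    (unitInterval.symm q)) fun s t ht => ?_⟩
  classical
  have hinj : Function.Injective fun x : V => (⟨x, h x.2⟩ : Λ) := fun x y hxy =>
    Subtype.ext (congrArg (fun z : Λ => (z : ℤ)) hxy)
  rw [Measure.map_apply hm (.pi s.countable_toSet fun i _ => ht i)]
  set T : Λ → Set Bool := fun y => if hy : (y : ℤ) ∈ V then t ⟨y, hy⟩ else Set.univ with hT
  have : restrictConfig h ⁻¹' (Set.pi s t) =
      Set.pi ((s.map ⟨_, hinj⟩ : Finset Λ) : Set Λ) T := by
    ext σ
    simp only [Set.mem_preimage, Set.mem_pi, Finset.mem_coe, Finset.mem_map,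
      Function.Embedding.coeFn_mk, forall_exists_index, and_imp, forall_apply_eq_imp_iff₂]
    refine forall₂_congr fun x _ => ?_
    simp [hT, restrictConfig]
  rw [this, productMeasure, Measure.infinitePi_pi, Finset.prod_map]
  · refine Finset.prod_congr rfl fun x _ => ?_
    simp [hT]
  · intro y _
    rw [hT]
    dsimp only
    split_ifs
    exacts [ht _, .univ]

/-- Enlarging the set of sites decreases the gap: a local function on the smaller set is a local
function on the larger one, and the constraints of the larger set are more restrictive. -/
theorem gap_anti (h0 : 0 < q) (h1 : q < 1) {V Λ : Set ℤ} (h : V ⊆ Λ) : gap q Λ ≤ gap q V := by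
  refine ENNReal.le_of_forall_nnreal_lt fun r hr => ?_
  refine (le_gap_iff h0 h1 ENNReal.coe_ne_top).2 fun f hf => ?_
  have hmp := measurePreserving_restrictConfig (q := q) h
  have hfm := hf.measurable
  have hloc : IsLocal (f ∘ restrictConfig h) := by
    classical
    obtain ⟨s, hs⟩ := hf
    refine ⟨s.image fun x : V => (⟨x, h x.2⟩ : Λ), fun σ τ hστ => hs fun x hx => hστ ⟨x, h x.2⟩ ?_⟩
    exact Finset.mem_coe.2 (Finset.mem_image_of_mem _ hx)
  have hvar : evariance (f ∘ restrictConfig h) (productMeasure q Λ) =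
      evariance f (productMeasure q V) := by
    rw [evariance, evariance, ← hmp.lintegral_comp (by fun_prop), ← hmp.map_eq,
      integral_map hmp.measurable.aemeasurable hfm.aestronglyMeasurable]
    rfl
  rw [← hvar]
  refine ((le_gap_iff h0 h1 ENNReal.coe_ne_top).1 hr.le _ hloc).trans ?_
  rw [East.dirichletForm_eq, East.dirichletForm_eq]
  refine mul_le_mul' le_rfl ?_
  have hinj : Function.Injective fun x : V => (⟨x, h x.2⟩ : Λ) := fun x y hxy =>
    Subtype.ext (congrArg (fun z : Λ => (z : ℤ)) hxy)
  rw [← hinj.tsum_eq]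
  · refine ENNReal.tsum_le_tsum fun x => ?_
    unfold siteEnergy
    rw [← hmp.lintegral_comp (by fun_prop)]
    refine lintegral_mono fun σ => ENNReal.ofReal_le_ofReal ?_
    have hflip : restrictConfig h (flipAt σ ⟨x, h x.2⟩) = flipAt (restrictConfig h σ) x := by
      funext y
      unfold restrictConfig flipAt
      by_cases hy : y = x
      · subst hy; simp
      · have : (⟨y, h y.2⟩ : Λ) ≠ ⟨x, h x.2⟩ := fun H => hy (hinj H)
        simp [Function.update_of_ne hy, Function.update_of_ne this]
    have hc : constraint (⟨x, h x.2⟩ : Λ) σ ≤ constraint x (restrictConfig h σ) := by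
      by_cases hx : (x : ℤ) + 1 ∈ V
      · exact le_of_eq (by
          rw [constraint, constraint, dif_pos hx, dif_pos (h hx)]
          rfl)
      · have : constraint x (restrictConfig h σ) = 1 := by simp [constraint, hx]
        rw [this]
        rcases constraint_mem (⟨x, h x.2⟩ : Λ) σ with h | h <;> simp [h]
    simp only [Function.comp_apply, hflip]
    refine mul_le_mul_of_nonneg_right (mul_le_mul_of_nonneg_right hc ?_) (sq_nonneg _)
    have := q.2.1
    have := q.2.2
    have ho : occ σ ⟨x, h x.2⟩ = occ (restrictConfig h σ) x := rfl
    rw [ho]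
    rcases occ_mem (restrictConfig h σ) x with h | h <;> rw [h] <;> linarith
  · intro y hy
    by_contra hny
    refine hy ?_
    have hflip : ∀ σ, restrictConfig h (flipAt σ y) = restrictConfig h σ := fun σ => by
      funext x
      unfold restrictConfig flipAt
      rw [Function.update_of_ne fun H => hny ⟨x, H⟩]
    simp [siteEnergy, hflip]

/-! ### Averaging operators -/

section Averaging

variable {X : Type*}

/-- Algebraic conditional expectations on real functions: positive unital linear maps `P` with
`P (P f * g) = P f * P g`. -/
structure IsAveraging (P : Module.End ℝ (X → ℝ)) : Prop where
  nonneg : ∀ f, 0 ≤ f → 0 ≤ P f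
  map_one : P 1 = 1
  map_mul : ∀ f g, P (P f * g) = P f * P g

/-- The conditional variance `P (f²) - (P f)²`. -/
def opVar (P : Module.End ℝ (X → ℝ)) (f : X → ℝ) : X → ℝ := P (f ^ 2) - P f ^ 2

namespace IsAveraging

variable {P Q R : Module.End ℝ (X → ℝ)}

lemma mono (hP : IsAveraging P) {f g : X → ℝ} (h : f ≤ g) : P f ≤ P g := by
  have := hP.nonneg (g - f) (sub_nonneg.2 h)
  rwa [map_sub, sub_nonneg] at this

lemma idem (hP : IsAveraging P) (f : X → ℝ) : P (P f) = P f := by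
  simpa [hP.map_one] using hP.map_mul f 1

lemma pull (hP : IsAveraging P) {h : X → ℝ} (hh : P h = h) (g : X → ℝ) :
    P (h * g) = h * P g := by
  simpa [hh] using hP.map_mul h g

lemma mul_fixed (hP : IsAveraging P) {g h : X → ℝ} (hg : P g = g) (hh : P h = h) :
    P (g * h) = g * h := by
  rw [hP.pull hg, hh]

lemma opVar_fixed (hP : IsAveraging P) (f : X → ℝ) : P (opVar P f) = opVar P f := by
  rw [opVar, map_sub, hP.idem, sq (P f), hP.map_mul, hP.idem]

lemma opVar_eq (hP : IsAveraging P) (f : X → ℝ) : opVar P f = P ((f - P f) ^ 2) := by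
  have : (f - P f) ^ 2 = f ^ 2 - (P f * f + P f * (f - P f)) := by ring
  rw [this, map_sub, map_add, hP.map_mul, hP.map_mul, map_sub, hP.idem, opVar]
  ring

lemma opVar_nonneg (hP : IsAveraging P) (f : X → ℝ) : 0 ≤ opVar P f := by
  rw [hP.opVar_eq]
  exact hP.nonneg _ fun σ => sq_nonneg _

lemma opVar_of_fixed (hP : IsAveraging P) {f : X → ℝ} (hf : P f = f) : opVar P f = 0 := by
  simp [hP.opVar_eq, hf]

lemma opVar_le (hP : IsAveraging P) {h : X → ℝ} (hh : P h = h) (f : X → ℝ) :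
    opVar P f ≤ P ((f - h) ^ 2) := by
  have : (f - h) ^ 2 = f ^ 2 - (h * f + h * (f - h)) := by ring
  rw [this, map_sub, map_add, hP.pull hh, hP.pull hh, map_sub, hh, opVar]
  intro σ
  simp only [Pi.sub_apply, Pi.add_apply, Pi.mul_apply, Pi.pow_apply]
  nlinarith [sq_nonneg (P f σ - h σ)]

lemma cauchy_schwarz (hP : IsAveraging P) (f g : X → ℝ) :
    P (f * g) ^ 2 ≤ P (f ^ 2) * P (g ^ 2) := by
  intro σ
  have h : ∀ t : ℝ, 0 ≤ P (g ^ 2) σ * (t * t) + 2 * P (f * g) σ * t + P (f ^ 2) σ := fun t => by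
    have h0 := hP.nonneg ((f + t • g) ^ 2) (fun σ => sq_nonneg _) σ
    have e : (f + t • g) ^ 2 = f ^ 2 + (2 * t) • (f * g) + (t * t) • g ^ 2 := by
      funext τ
      simp only [Pi.pow_apply, Pi.add_apply, Pi.smul_apply, Pi.mul_apply, smul_eq_mul]
      ring
    rw [e, map_add, map_add, map_smul, map_smul] at h0
    simp only [Pi.zero_apply, Pi.add_apply, Pi.smul_apply, smul_eq_mul] at h0
    linarith
  have := discrim_le_zero h
  rw [discrim] at this
  simp only [Pi.pow_apply, Pi.mul_apply]
  linarith

lemma opVar_add_le (hP : IsAveraging P) (f g : X → ℝ) :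
    opVar P (f + g) ≤ (2 : ℝ) • opVar P f + (2 : ℝ) • opVar P g := by
  rw [hP.opVar_eq, hP.opVar_eq, hP.opVar_eq, ← map_smul, ← map_smul, ← map_add, map_add P f g]
  refine hP.mono fun σ => ?_
  simp only [Pi.pow_apply, Pi.add_apply, Pi.sub_apply, Pi.smul_apply, smul_eq_mul]
  nlinarith [sq_nonneg ((f σ - P f σ) - (g σ - P g σ))]

lemma opVar_mul (hP : IsAveraging P) {c : X → ℝ} (hc : P c = c) (f : X → ℝ) :
    opVar P (c * f) = c ^ 2 * opVar P f := by
  rw [opVar, opVar, mul_pow, hP.pull hc, hP.pull (by rw [sq, hP.mul_fixed hc hc])]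
  ring

lemma mul (hP : IsAveraging P) (hQ : IsAveraging Q) (h : Commute P Q) : IsAveraging (P * Q) where
  nonneg f hf := hP.nonneg _ (hQ.nonneg _ hf)
  map_one := by rw [Module.End.mul_apply, hQ.map_one, hP.map_one]
  map_mul f g := by
    have e : (P * Q) f = Q (P f) := by rw [h.eq]; rfl
    rw [Module.End.mul_apply P Q (_ * g), e, hQ.map_mul, ← e, Module.End.mul_apply, hP.map_mul]
    rfl

lemma _root_.Commute.end_apply (h : Commute P Q) (f : X → ℝ) : P (Q f) = Q (P f) :=
  congrArg (fun T : Module.End ℝ (X → ℝ) => T f) h.eq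

/-- The law of total variance. -/
lemma opVar_comp (P Q : Module.End ℝ (X → ℝ)) (f : X → ℝ) :
    opVar (P * Q) f = P (opVar Q f) + opVar P (Q f) := by
  simp only [opVar, Module.End.mul_apply, map_sub]
  ring

/-- Averaging decreases the conditional variance with respect to the other variables. -/
lemma opVar_apply_le (hP : IsAveraging P) (hQ : IsAveraging Q) (h : Commute P Q) (f : X → ℝ) :
    opVar P (Q f) ≤ Q (opVar P f) := by
  rw [hP.opVar_eq, hP.opVar_eq, h.end_apply, ← map_sub, ← h.end_apply]
  refine hP.mono ?_
  have := hQ.cauchy_schwarz 1 (f - P f)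
  rwa [one_pow, hQ.map_one, one_mul, one_mul] at this

lemma apply_opVar_le (hP : IsAveraging P) (hQ : IsAveraging Q) (h : Commute P Q) (f : X → ℝ) :
    (P * Q) (opVar P f) ≤ opVar (P * Q) f := by
  rw [h.eq, opVar_comp, Module.End.mul_apply, hP.opVar_fixed]
  exact le_add_of_nonneg_right (hQ.opVar_nonneg _)

/-- A two-block Poincaré inequality with a constraint: the first block is resampled only when the
event with indicator `c`, determined by the second block and of probability `θ`, occurs. -/
theorem opVar_le_two_blocks (hP : IsAveraging P) (hQ : IsAveraging Q) (h : Commute P Q)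
    {c : X → ℝ} (hPc : P c = c) (hcc : c ^ 2 = c) {θ : ℝ} (hθ : 0 < θ)
    (hQc : Q c = fun _ => θ) (f : X → ℝ) :
    opVar (P * Q) f ≤ (2 / θ) • (P * Q) (c * opVar P f + opVar Q f) := by
  -- `Q f` is split into the average of `f` over the event and a correction
  have hsplit : Q f = θ⁻¹ • Q (c * f) + Q ((1 - θ⁻¹ • c) * (f - Q f)) := by
    have e : (1 - θ⁻¹ • c) * (f - Q f) =
        f - θ⁻¹ • (c * f) - (Q f * (1 - θ⁻¹ • c)) := by
      funext σ
      simp only [Pi.mul_apply, Pi.sub_apply, Pi.smul_apply, Pi.one_apply, smul_eq_mul]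
      ring
    have e2 : Q (1 - θ⁻¹ • c) = 0 := by
      rw [map_sub, map_smul, hQ.map_one, hQc]
      funext σ
      simp [hθ.ne']
    rw [e, map_sub, map_sub, hQ.map_mul, e2, map_smul]
    simp
  have h1 : opVar P (θ⁻¹ • Q (c * f)) ≤ θ⁻¹ • Q (c * opVar P f) := by
    have ec : P (Q (c * f)) = Q (c * P f) := by rw [h.end_apply, hP.pull hPc]
    have hle : P ((Q (c * (f - P f))) ^ 2) ≤ θ • Q (c * opVar P f) := by
      have hcs := hQ.cauchy_schwarz c (c * (f - P f))
      rw [hcc, hQc, show c * (c * (f - P f)) = c ^ 2 * (f - P f) by ring, hcc,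
        show (c * (f - P f)) ^ 2 = c ^ 2 * (f - P f) ^ 2 by ring, hcc] at hcs
      have e : P (Q (c * (f - P f) ^ 2)) = Q (c * opVar P f) := by
        rw [h.end_apply, hP.pull hPc, hP.opVar_eq]
      rw [← e, ← map_smul]
      exact hP.mono hcs
    have e : opVar P (θ⁻¹ • Q (c * f)) = (θ⁻¹ * θ⁻¹) • P ((Q (c * (f - P f))) ^ 2) := by
      rw [hP.opVar_eq, map_smul, ec, ← smul_sub, ← map_sub, ← mul_sub, smul_pow, map_smul, sq]
    rw [e]
    intro σ
    have := hle σ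
    simp only [Pi.smul_apply, smul_eq_mul] at this ⊢
    have h2 : 0 ≤ θ⁻¹ * θ⁻¹ := by positivity
    calc _ ≤ θ⁻¹ * θ⁻¹ * (θ * _) := mul_le_mul_of_nonneg_left this h2
      _ = _ := by field_simp
  have h2 : opVar P (Q ((1 - θ⁻¹ • c) * (f - Q f))) ≤ (θ⁻¹ - 1) • P (opVar Q f) := by
    have hcs := hQ.cauchy_schwarz (1 - θ⁻¹ • c) (f - Q f)
    have e : Q ((1 - θ⁻¹ • c) ^ 2) = fun _ => θ⁻¹ - 1 := by
      have : (1 - θ⁻¹ • c) ^ 2 = 1 - (2 * θ⁻¹) • c + (θ⁻¹ * θ⁻¹) • c ^ 2 := by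
        funext σ
        simp only [Pi.pow_apply, Pi.add_apply, Pi.sub_apply, Pi.smul_apply, Pi.one_apply,
          smul_eq_mul]
        ring
      rw [this, hcc, map_add, map_sub, map_smul, map_smul, hQ.map_one, hQc]
      funext σ
      simp only [Pi.add_apply, Pi.sub_apply, Pi.smul_apply, Pi.one_apply, smul_eq_mul]
      field_simp
      ring
    rw [e, ← hQ.opVar_eq] at hcs
    have := (hP.opVar_le (h := 0) (map_zero _) (Q ((1 - θ⁻¹ • c) * (f - Q f))))
    rw [sub_zero] at this
    refine this.trans ?_
    rw [← map_smul]
    exact hP.mono hcs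
  have e1 : (P * Q) (c * opVar P f) = Q (c * opVar P f) := by
    rw [h.eq, Module.End.mul_apply, hP.mul_fixed hPc (hP.opVar_fixed f)]
  have e2 : (P * Q) (opVar Q f) = P (opVar Q f) := by
    rw [Module.End.mul_apply, hQ.opVar_fixed]
  have h3 := hP.opVar_add_le (θ⁻¹ • Q (c * f)) (Q ((1 - θ⁻¹ • c) * (f - Q f)))
  rw [← hsplit] at h3
  rw [opVar_comp, map_add, e1, e2]
  intro σ
  have h1 := h1 σ
  have h2 := h2 σ
  have h3 := h3 σ
  have h4 := hP.nonneg _ (hQ.opVar_nonneg f) σ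
  simp only [Pi.add_apply, Pi.smul_apply, smul_eq_mul, Pi.zero_apply] at h1 h2 h3 h4 ⊢
  rw [div_eq_mul_inv]
  nlinarith

/-- The variance of the first block is controlled by the constrained variance, up to an error which
is small when the constraint, determined by the second block, holds with high probability. -/
theorem opVar_apply_le_constrained (hP : IsAveraging P) (hQ : IsAveraging Q) (hR : IsAveraging R)
    (hPQ : Commute P Q) (hPR : Commute P R) {c : X → ℝ} (hPc : P c = c) (hRc : R c = c)
    (hcc : c ^ 2 = c) {ε : ℝ} (hQc : Q (1 - c) = fun _ => ε) (hc0 : 0 ≤ c) (f : X → ℝ) :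
    opVar P (Q (R f)) ≤ (2 : ℝ) • Q (R (c * opVar P f)) +
      (2 * ε) • (P (opVar Q (R f)) + opVar P (Q (R f))) := by
  have hsplit : Q (R f) = Q (c * R f) + Q ((1 - c) * R f) := by
    rw [← map_add]; congr 1; ring
  have h1 : opVar P (Q (c * R f)) ≤ Q (R (c * opVar P f)) := by
    refine (hP.opVar_apply_le hQ hPQ _).trans (hQ.mono ?_)
    rw [hP.opVar_mul hPc, hcc, hR.pull hRc]
    exact fun σ => mul_le_mul_of_nonneg_left (hP.opVar_apply_le hR hPR f σ) (hc0 σ)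
  have h2 : opVar P (Q ((1 - c) * R f)) ≤ ε • opVar (P * Q) (R f) := by
    have hP1c : P (1 - c) = 1 - c := by rw [map_sub, hP.map_one, hPc]
    have hfix : P (Q ((1 - c) * (P * Q) (R f))) = Q ((1 - c) * (P * Q) (R f)) := by
      rw [hPQ.end_apply, hP.pull hP1c, Module.End.mul_apply, hP.idem]
    refine (hP.opVar_le hfix _).trans ?_
    have e : ∀ g, ε • (P * Q) g = P (ε • Q g) := fun g => by rw [map_smul]; rfl
    rw [(hP.mul hQ hPQ).opVar_eq, ← map_sub, ← mul_sub, e]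
    refine hP.mono ?_
    have hcs := hQ.cauchy_schwarz (1 - c) (R f - (P * Q) (R f))
    rwa [show (1 - c) ^ 2 = 1 - 2 * c + c ^ 2 by ring, hcc,
      show 1 - 2 * c + c = 1 - c by ring, hQc] at hcs
  have h3 := hP.opVar_add_le (Q (c * R f)) (Q ((1 - c) * R f))
  rw [← hsplit] at h3
  rw [← opVar_comp]
  intro σ
  have h1 := h1 σ
  have h2 := h2 σ
  have h3 := h3 σ
  simp only [Pi.add_apply, Pi.smul_apply, smul_eq_mul] at h1 h2 h3 ⊢
  linarith

end IsAveraging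

end Averaging

/-! ### Block inequalities and bisection -/

/-- The average over the occupation of one site. -/
def siteAvg (q : unitInterval) (x : Λ) : Module.End ℝ (Config Λ → ℝ) where
  toFun f σ := (1 - q) * f (Function.update σ x true) + q * f (Function.update σ x false)
  map_add' f g := by funext σ; simp only [Pi.add_apply]; ring
  map_smul' a f := by funext σ; simp only [Pi.smul_apply, smul_eq_mul, RingHom.id_apply]; ring

lemma siteAvg_apply (x : Λ) (f : Config Λ → ℝ) (σ : Config Λ) :
    siteAvg q x f σ =
      (1 - q) * f (Function.update σ x true) + q * f (Function.update σ x false) := rfl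

lemma isAveraging_siteAvg (x : Λ) : IsAveraging (siteAvg q x) where
  nonneg f hf σ := by
    have := q.2.1
    have : 0 ≤ 1 - (q : ℝ) := by linarith [q.2.2]
    have h1 := hf (Function.update σ x true)
    have h2 := hf (Function.update σ x false)
    simp only [Pi.zero_apply] at h1 h2
    rw [Pi.zero_apply, siteAvg_apply]
    positivity
  map_one := by funext σ; simp [siteAvg_apply]
  map_mul f g := by
    funext σ
    simp only [siteAvg_apply, Pi.mul_apply, Function.update_idem]
    ring

lemma siteAvg_of_update {x : Λ} {f : Config Λ → ℝ}
    (h : ∀ σ b, f (Function.update σ x b) = f σ) : siteAvg q x f = f := by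
  funext σ
  rw [siteAvg_apply, h, h]
  ring

lemma commute_siteAvg (x y : Λ) : Commute (siteAvg q x) (siteAvg q y) := by
  by_cases h : x = y
  · subst h; exact Commute.refl _
  · refine LinearMap.ext fun f => funext fun σ => ?_
    simp only [Module.End.mul_apply, siteAvg_apply, Function.update_comm h]
    ring

lemma opVar_siteAvg (x : Λ) (f : Config Λ → ℝ) (σ : Config Λ) :
    opVar (siteAvg q x) f σ = q * (1 - q) *
      (f (Function.update σ x true) - f (Function.update σ x false)) ^ 2 := by
  simp only [opVar, Pi.sub_apply, Pi.pow_apply, siteAvg_apply]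
  ring

/-- The site `z`, as an element of the index type of the infinite-volume configurations. -/
abbrev site (z : ℤ) : (Set.univ : Set ℤ) := ⟨z, trivial⟩

lemma site_injective : Function.Injective site := fun _ _ h => congrArg Subtype.val h

/-- The average over the occupation of the sites `a, …, a + n - 1`. -/
def blockAvg (q : unitInterval) : ℤ → ℕ → Module.End ℝ (Config Set.univ → ℝ)
  | _, 0 => 1
  | a, n + 1 => siteAvg q (site a) * blockAvg q (a + 1) n

lemma commute_siteAvg_blockAvg (x : (Set.univ : Set ℤ)) (a : ℤ) (n : ℕ) :
    Commute (siteAvg q x) (blockAvg q a n) := by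
  induction n generalizing a with
  | zero => exact Commute.one_right _
  | succ n ih => exact (commute_siteAvg _ _).mul_right (ih _)

lemma commute_blockAvg (a b : ℤ) (m n : ℕ) : Commute (blockAvg q a m) (blockAvg q b n) := by
  induction m generalizing a with
  | zero => exact Commute.one_left _
  | succ m ih => exact (commute_siteAvg_blockAvg _ _ _).mul_left (ih _)

lemma isAveraging_blockAvg (a : ℤ) (n : ℕ) : IsAveraging (blockAvg q a n) := by
  induction n generalizing a with
  | zero => exact ⟨fun _ h => h, rfl, fun _ _ => rfl⟩
  | succ n ih => exact (isAveraging_siteAvg _).mul (ih _) (commute_siteAvg_blockAvg _ _ _)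

lemma blockAvg_add (a : ℤ) (m n : ℕ) :
    blockAvg q a (m + n) = blockAvg q a m * blockAvg q (a + m) n := by
  induction m generalizing a with
  | zero => simp [blockAvg]
  | succ m ih =>
    rw [show m + 1 + n = (m + n) + 1 by omega, blockAvg, blockAvg, ih, mul_assoc]
    congr 3
    push_cast
    ring

lemma blockAvg_one (a : ℤ) : blockAvg q a 1 = siteAvg q (site a) := by
  simp [blockAvg]

lemma blockAvg_of_siteAvg {a : ℤ} {n : ℕ} {f : Config Set.univ → ℝ}
    (h : ∀ i < n, siteAvg q (site (a + i)) f = f) : blockAvg q a n f = f := by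
  induction n generalizing a with
  | zero => rfl
  | succ n ih =>
    rw [blockAvg, Module.End.mul_apply, ih fun i hi => ?_]
    · simpa using h 0 (Nat.succ_pos n)
    · have := h (i + 1) (by omega)
      rwa [show a + ((i + 1 : ℕ) : ℤ) = a + 1 + i by push_cast; ring] at this

/-- The indicator that the site `z` is empty. -/
def vac (z : ℤ) (σ : Config Set.univ) : ℝ := if σ (site z) = true then 0 else 1

lemma vac_mem (z : ℤ) (σ : Config Set.univ) : vac z σ = 0 ∨ vac z σ = 1 := by
  unfold vac; split_ifs <;> simp

lemma vac_nonneg (z : ℤ) : 0 ≤ vac z := fun σ => by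
  rcases vac_mem z σ with h | h <;> simp [h]

lemma vac_le_one (z : ℤ) : vac z ≤ 1 := fun σ => by
  rcases vac_mem z σ with h | h <;> simp [h]

lemma vac_sq (z : ℤ) : vac z ^ 2 = vac z := by
  funext σ; rcases vac_mem z σ with h | h <;> simp [h]

lemma siteAvg_vac_of_ne {z w : ℤ} (h : z ≠ w) : siteAvg q (site z) (vac w) = vac w :=
  siteAvg_of_update fun σ b => by
    have : site w ≠ site z := fun H => h (site_injective H).symm
    simp [vac, Function.update_of_ne this]

lemma blockAvg_vac {a z : ℤ} {n : ℕ} (h : z < a ∨ a + n ≤ z) : blockAvg q a n (vac z) = vac z :=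
  blockAvg_of_siteAvg fun i hi => siteAvg_vac_of_ne (by omega)

/-- The indicator that none of the sites `a, …, a + n - 1` is empty. -/
def full (a : ℤ) (n : ℕ) : Config Set.univ → ℝ := ∏ i ∈ Finset.range n, (1 - vac (a + i))

lemma full_succ (a : ℤ) (n : ℕ) : full a (n + 1) = full a n * (1 - vac (a + n)) :=
  Finset.prod_range_succ _ _

lemma full_succ' (a : ℤ) (n : ℕ) : full a (n + 1) = (1 - vac a) * full (a + 1) n := by
  rw [full, Finset.prod_range_succ', mul_comm, full]
  simp [add_assoc, add_comm (1 : ℤ)]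

lemma full_sq (a : ℤ) (n : ℕ) : full a n ^ 2 = full a n := by
  rw [full, ← Finset.prod_pow]
  refine Finset.prod_congr rfl fun i _ => ?_
  rw [show (1 - vac (a + i)) ^ 2 = 1 - 2 * vac (a + i) + vac (a + i) ^ 2 by ring, vac_sq]
  ring

lemma full_le_one (a : ℤ) (n : ℕ) : full a n ≤ 1 := by
  intro σ
  have : full a n σ ^ 2 = full a n σ := congrFun (full_sq a n) σ
  simp only [Pi.one_apply]
  nlinarith

lemma blockAvg_full_of_disjoint {a b : ℤ} {m n : ℕ} (h : b + n ≤ a ∨ a + m ≤ b) :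
    blockAvg q a m (full b n) = full b n := by
  induction n with
  | zero => exact (isAveraging_blockAvg a m).map_one
  | succ n ih =>
    rw [full_succ]
    refine (isAveraging_blockAvg a m).mul_fixed (ih (by omega)) ?_
    rw [map_sub, (isAveraging_blockAvg a m).map_one, blockAvg_vac (by omega)]

lemma blockAvg_full (a : ℤ) (n : ℕ) :
    blockAvg q a n (full a n) = fun _ => (1 - (q : ℝ)) ^ n := by
  induction n generalizing a with
  | zero =>
    rw [(show full a 0 = 1 from rfl), (isAveraging_blockAvg a 0).map_one]
    simp; rfl
  | succ n ih =>
    have h1 : blockAvg q (a + 1) n (1 - vac a) = 1 - vac a := by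
      rw [map_sub, (isAveraging_blockAvg _ n).map_one, blockAvg_vac (by omega)]
    rw [full_succ', blockAvg, Module.End.mul_apply, (isAveraging_blockAvg _ n).pull h1, ih]
    funext σ
    simp [siteAvg_apply, vac, pow_succ]
    ring

lemma blockAvg_full_of_le (a : ℤ) {d n : ℕ} (h : d ≤ n) :
    blockAvg q a n (full a d) = fun _ => (1 - (q : ℝ)) ^ d := by
  obtain ⟨k, rfl⟩ := Nat.exists_eq_add_of_le h
  rw [blockAvg_add, Module.End.mul_apply, blockAvg_full_of_disjoint (by omega), blockAvg_full]

/-- The energy density of the sites `a, …, a + n - 1`, each constrained by its right neighbour. -/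
def energy (q : unitInterval) (a : ℤ) (n : ℕ) (f : Config Set.univ → ℝ) : Config Set.univ → ℝ :=
  ∑ i ∈ Finset.range n, vac (a + i + 1) * opVar (siteAvg q (site (a + i))) f

lemma energy_add (a : ℤ) (m n : ℕ) (f : Config Set.univ → ℝ) :
    energy q a (m + n) f = energy q a m f + energy q (a + m) n f := by
  rw [energy, Finset.sum_range_add, energy, energy]
  congr 1
  refine Finset.sum_congr rfl fun i _ => ?_
  push_cast
  simp only [add_assoc]

lemma energy_nonneg (a : ℤ) (n : ℕ) (f : Config Set.univ → ℝ) : 0 ≤ energy q a n f :=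
  Finset.sum_nonneg fun _ _ => mul_nonneg (vac_nonneg _) ((isAveraging_siteAvg _).opVar_nonneg _)

lemma energy_le_of_le (a : ℤ) {m n : ℕ} (h : m ≤ n) (f : Config Set.univ → ℝ) :
    energy q a m f ≤ energy q a n f := by
  obtain ⟨k, rfl⟩ := Nat.exists_eq_add_of_le h
  rw [energy_add]
  exact le_add_of_nonneg_right (energy_nonneg _ _ _)

/-- The Poincaré inequality with constant `C` on all blocks of `n` sites whose right neighbour is
empty. -/
def BlockPoincare (q : unitInterval) (n : ℕ) (C : ℝ) : Prop :=
  ∀ (a : ℤ) (f : Config Set.univ → ℝ),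
    vac (a + n) * opVar (blockAvg q a n) f ≤ C • (vac (a + n) * blockAvg q a n (energy q a n f))

lemma BlockPoincare.mono {n : ℕ} {C D : ℝ} (h : BlockPoincare q n C) (hCD : C ≤ D) :
    BlockPoincare q n D := fun a f => (h a f).trans (smul_le_smul_of_nonneg_right hCD
      (mul_nonneg (vac_nonneg _) ((isAveraging_blockAvg _ _).nonneg _ (energy_nonneg _ _ _))))

lemma blockPoincare_zero {C : ℝ} (hC : 0 ≤ C) : BlockPoincare q 0 C := fun a f => by
  rw [(isAveraging_blockAvg a 0).opVar_of_fixed rfl, mul_zero]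
  exact smul_nonneg hC
    (mul_nonneg (vac_nonneg _) ((isAveraging_blockAvg _ _).nonneg _ (energy_nonneg _ _ _)))

lemma blockPoincare_one : BlockPoincare q 1 1 := fun a f => by
  have hS := isAveraging_siteAvg (q := q) (site a)
  have e : energy q a 1 f = vac (a + 1) * opVar (siteAvg q (site a)) f := by simp [energy]
  have hv : siteAvg q (site a) (vac (a + 1)) = vac (a + 1) := siteAvg_vac_of_ne (by omega)
  rw [blockAvg_one, e, hS.mul_fixed hv (hS.opVar_fixed f), one_smul, ← mul_assoc]
  push_cast
  rw [← sq, vac_sq]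

/-- If one of the `d` sites to the right of a block is empty, the block can be enlarged up to the
rightmost such site and then has an empty right neighbour. -/
theorem blockAvg_facilitated_le {m d : ℕ} {C : ℝ} (hC : 0 ≤ C)
    (H : ∀ k < d, BlockPoincare q (m + k) C) (a : ℤ) (f : Config Set.univ → ℝ) :
    blockAvg q a (m + d) ((1 - full (a + m) d) * opVar (blockAvg q a m) f) ≤
      C • blockAvg q a (m + d) (energy q a (m + d) f) := by
  induction d with
  | zero =>
    rw [(show full (a + m) 0 = 1 from rfl), sub_self, zero_mul, map_zero]
    exact smul_nonneg hC ((isAveraging_blockAvg _ _).nonneg _ (energy_nonneg _ _ _))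
  | succ d ih =>
    have ih := ih fun k hk => H k (hk.trans (Nat.lt_succ_self d))
    have hB := isAveraging_blockAvg (q := q) a (m + d)
    have hS := isAveraging_siteAvg (q := q) (site (a + (m + d : ℕ)))
    have hN := isAveraging_blockAvg (q := q) a (m + d + 1)
    have hsplit : ∀ g, blockAvg q a (m + d + 1) g =
        siteAvg q (site (a + (m + d : ℕ))) (blockAvg q a (m + d) g) := fun g => by
      rw [blockAvg_add, blockAvg_one, Module.End.mul_apply,
        ← (commute_siteAvg_blockAvg _ _ _).end_apply]
    set w := vac (a + (m + d : ℕ)) with hw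
    have hBw : blockAvg q a (m + d) w = w := blockAvg_vac (Or.inr le_rfl)
    have hBw' : blockAvg q a (m + d) (1 - w) = 1 - w := by rw [map_sub, hB.map_one, hBw]
    have hw1 : 0 ≤ 1 - w := sub_nonneg.2 (vac_le_one _)
    have e : (1 - full (a + m) (d + 1)) * opVar (blockAvg q a m) f =
        w * opVar (blockAvg q a m) f +
          (1 - w) * ((1 - full (a + m) d) * opVar (blockAvg q a m) f) := by
      rw [full_succ, hw, show a + m + (d : ℤ) = a + (m + d : ℕ) by push_cast; ring]
      ring
    -- the site `a + m + d` is empty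
    have h1 : blockAvg q a (m + d) (w * opVar (blockAvg q a m) f) ≤
        C • blockAvg q a (m + d) (w * energy q a (m + d) f) := by
      rw [hB.pull hBw, hB.pull hBw]
      refine le_trans (fun σ => mul_le_mul_of_nonneg_left ?_ (vac_nonneg _ σ))
        (H d (Nat.lt_succ_self d) a f)
      have := (isAveraging_blockAvg (q := q) a m).apply_opVar_le (isAveraging_blockAvg (a + m) d)
        (commute_blockAvg _ _ _ _) f
      rw [← blockAvg_add] at this
      exact this σ
    -- the site `a + m + d` is occupied
    have h2 : blockAvg q a (m + d)
          ((1 - w) * ((1 - full (a + m) d) * opVar (blockAvg q a m) f)) ≤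
        C • blockAvg q a (m + d) ((1 - w) * energy q a (m + d) f) := by
      rw [hB.pull hBw', hB.pull hBw', ← mul_smul_comm]
      exact fun σ => mul_le_mul_of_nonneg_left (ih σ) (hw1 σ)
    have h3 : blockAvg q a (m + d + 1) ((1 - full (a + m) (d + 1)) * opVar (blockAvg q a m) f) ≤
        C • blockAvg q a (m + d + 1) (energy q a (m + d) f) := by
      rw [hsplit, hsplit, ← map_smul]
      refine hS.mono ?_
      rw [e, map_add]
      refine (add_le_add h1 h2).trans (le_of_eq ?_)
      rw [← smul_add, ← map_add]
      congr 2
      ring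
    exact h3.trans (smul_le_smul_of_nonneg_left
      (hN.mono (energy_le_of_le a (Nat.le_succ _) f)) hC)

/-- Bisection: two blocks whose overlap has `d` sites are put together at the cost of a factor
inversely proportional to the probability of an empty site in the overlap. -/
theorem BlockPoincare.bisect {L d : ℕ} {C : ℝ} (hq : 0 < q) (hC : 0 ≤ C)
    (H : ∀ n ≤ L, BlockPoincare q n C) (hd : 0 < d) (hdL : d ≤ L) :
    ∀ n ≤ 2 * L + 1 - d, BlockPoincare q n (4 * C / (1 - (1 - (q : ℝ)) ^ d)) := by
  have hq0 : (0 : ℝ) < q := hq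
  have hq1 : (q : ℝ) ≤ 1 := q.2.2
  set θ := 1 - (1 - (q : ℝ)) ^ d with hθ
  have hθ0 : 0 < θ := sub_pos.2 (pow_lt_one₀ (by linarith) (by linarith) hd.ne')
  have hθ1 : θ ≤ 1 := sub_le_self _ (pow_nonneg (by linarith) _)
  intro n hn
  rcases le_or_gt n L with hnL | hnL
  · refine (H n hnL).mono ?_
    rw [le_div_iff₀ hθ0]
    nlinarith
  · obtain ⟨m, rfl⟩ := Nat.exists_eq_add_of_le' hnL.le
    intro a f
    have hP := isAveraging_blockAvg (q := q) a m
    have hQ := isAveraging_blockAvg (q := q) (a + m) L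
    have hB := isAveraging_blockAvg (q := q) a (m + L)
    have hBv : blockAvg q a (m + L) (vac (a + (m + L : ℕ))) = vac (a + (m + L : ℕ)) :=
      blockAvg_vac (Or.inr le_rfl)
    -- the right block has the maximal length `L`, the left one the remaining `m` sites
    have h1 := hP.opVar_le_two_blocks hQ (commute_blockAvg _ _ _ _) (c := 1 - full (a + m) d)
      (θ := θ) (by rw [map_sub, hP.map_one, blockAvg_full_of_disjoint (by omega)])
      (by rw [show (1 - full (a + m) d) ^ 2 = 1 - 2 * full (a + m) d + full (a + m) d ^ 2 by ring,
        full_sq]; ring) hθ0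
      (by rw [map_sub, hQ.map_one, blockAvg_full_of_le _ hdL]; rfl) f
    rw [← blockAvg_add, map_add] at h1
    have h2 : blockAvg q a (m + L) ((1 - full (a + m) d) * opVar (blockAvg q a m) f) ≤
        C • blockAvg q a (m + L) (energy q a (m + L) f) := by
      have := blockAvg_facilitated_le (q := q) (m := m) (d := d) hC
        (fun k hk => H _ (by omega)) a f
      have e : ∀ g, blockAvg q a (m + L) g =
          blockAvg q (a + (m + d : ℕ)) (L - d) (blockAvg q a (m + d) g) := fun g => by
        rw [show m + L = m + d + (L - d) by omega, blockAvg_add, Module.End.mul_apply,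
          (commute_blockAvg _ _ _ _).end_apply]
      have h' := (isAveraging_blockAvg (q := q) (a + (m + d : ℕ)) (L - d)).mono this
      rw [map_smul, ← e, ← e] at h'
      exact h'.trans (smul_le_smul_of_nonneg_left
        (hB.mono (energy_le_of_le a (by omega) f)) hC)
    have h3 : vac (a + (m + L : ℕ)) * blockAvg q a (m + L) (opVar (blockAvg q (a + m) L) f) ≤
        C • (vac (a + (m + L : ℕ)) * blockAvg q a (m + L) (energy q a (m + L) f)) := by
      have hle : energy q (a + m) L f ≤ energy q a (m + L) f := by
        rw [energy_add]; exact le_add_of_nonneg_left (energy_nonneg _ _ _)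
      rw [← hB.pull hBv, ← hB.pull hBv, ← map_smul]
      have h4 := H L le_rfl (a + m) f
      rw [show a + (m : ℤ) + L = a + (m + L : ℕ) by push_cast; ring] at h4
      refine (hB.mono h4).trans ?_
      rw [map_smul, map_smul, hB.pull hBv, hB.pull hBv]
      refine smul_le_smul_of_nonneg_left ?_ hC
      intro σ
      refine mul_le_mul_of_nonneg_left ?_ (vac_nonneg _ σ)
      have e : blockAvg q a (m + L) (blockAvg q (a + m) L (energy q (a + m) L f)) =
          blockAvg q a (m + L) (energy q (a + m) L f) := by
        rw [blockAvg_add, Module.End.mul_apply, hQ.idem, Module.End.mul_apply]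
      rw [e]
      exact hB.mono hle σ
    intro σ
    have h1 := h1 σ
    have h2 := h2 σ
    have h3 := h3 σ
    have hv := vac_nonneg (a + (m + L : ℕ)) σ
    simp only [Pi.mul_apply, Pi.add_apply, Pi.smul_apply, smul_eq_mul, Pi.zero_apply] at h1 h2 h3 hv ⊢
    set v := vac (a + (m + L : ℕ)) σ
    set E := blockAvg q a (m + L) (energy q a (m + L) f) σ
    set A₁ := blockAvg q a (m + L) ((1 - full (a + m) d) * opVar (blockAvg q a m) f) σ
    set A₂ := blockAvg q a (m + L) (opVar (blockAvg q (a + m) L) f) σ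
    calc v * opVar (blockAvg q a (m + L)) f σ
        ≤ v * (2 / θ * (A₁ + A₂)) := mul_le_mul_of_nonneg_left h1 hv
      _ = 2 / θ * (v * A₁ + v * A₂) := by ring
      _ ≤ 2 / θ * (v * (C * E) + C * (v * E)) := by gcongr
      _ = 4 * C / θ * (v * E) := by ring

/-- A chain of blocks of length `ℓ` so large that each of them contains an empty site with
probability at least `7/8`, up to a last block on which `f` does not depend. The energy of all blocks
but the first is counted twice, and the second term on the left carries the induction: it pays for
the error term of the block to the left. -/
theorem opVar_blockAvg_chain {ℓ : ℕ} {C : ℝ} (hC : 0 ≤ C)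
    (H : ∀ n < 2 * ℓ, BlockPoincare q n C) (hℓ : (1 - (q : ℝ)) ^ ℓ ≤ 1 / 8) (k : ℕ) (a : ℤ)
    (f : Config Set.univ → ℝ) (hf : blockAvg q (a + (k * ℓ : ℕ)) ℓ f = f) :
    opVar (blockAvg q a (ℓ + k * ℓ)) f +
        (1 / 2 : ℝ) • opVar (blockAvg q a ℓ) (blockAvg q (a + ℓ) (k * ℓ) f) ≤
      (4 * C) • blockAvg q a (ℓ + k * ℓ)
        (energy q a ℓ f + (2 : ℝ) • energy q (a + ℓ) (k * ℓ) f) := by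
  induction k generalizing a with
  | zero =>
    have hP := isAveraging_blockAvg (q := q) a ℓ
    rw [zero_mul, Nat.cast_zero, add_zero] at hf
    have e : opVar (blockAvg q a ℓ) f = 0 := hP.opVar_of_fixed hf
    have e' : blockAvg q (a + ℓ) 0 f = f := rfl
    simp only [zero_mul, add_zero, e, e', smul_zero]
    exact smul_nonneg (by positivity) (hP.nonneg _ (add_nonneg (energy_nonneg _ _ _)
      (smul_nonneg (by norm_num) (energy_nonneg _ _ _))))
  | succ k ih =>
    have hidx : (k + 1) * ℓ = ℓ + k * ℓ := by ring
    have ih := ih (a + ℓ) (by rwa [hidx, Nat.cast_add, ← add_assoc] at hf)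
    rw [hidx]
    have hP := isAveraging_blockAvg (q := q) a ℓ
    have hQ := isAveraging_blockAvg (q := q) (a + ℓ) ℓ
    have hR := isAveraging_blockAvg (q := q) (a + ℓ + ℓ) (k * ℓ)
    have hPR : Commute (blockAvg q a ℓ) (blockAvg q (a + ℓ + ℓ) (k * ℓ)) := commute_blockAvg _ _ _ _
    have e1 : ∀ g, blockAvg q (a + ℓ) (ℓ + k * ℓ) g =
        blockAvg q (a + ℓ) ℓ (blockAvg q (a + ℓ + ℓ) (k * ℓ) g) := fun g => by
      rw [blockAvg_add]; rfl
    set c : Config Set.univ → ℝ := 1 - full (a + ℓ) ℓ with hc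
    have hPc : blockAvg q a ℓ c = c := by
      rw [map_sub, hP.map_one, blockAvg_full_of_disjoint (by omega)]
    have hRc : blockAvg q (a + ℓ + ℓ) (k * ℓ) c = c := by
      rw [map_sub, hR.map_one, blockAvg_full_of_disjoint (by omega)]
    have h1 := hP.opVar_apply_le_constrained hQ hR (commute_blockAvg _ _ _ _) hPR hPc hRc
      (by rw [hc, show (1 - full (a + ℓ) ℓ) ^ 2 = 1 - 2 * full (a + ℓ) ℓ + full (a + ℓ) ℓ ^ 2 by
        ring, full_sq]; ring)
      (by rw [hc, sub_sub_cancel, blockAvg_full]) (sub_nonneg.2 (full_le_one _ _)) f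
    have h2 : blockAvg q (a + ℓ) ℓ (blockAvg q (a + ℓ + ℓ) (k * ℓ)
          (c * opVar (blockAvg q a ℓ) f)) ≤
        C • blockAvg q a (ℓ + (ℓ + k * ℓ)) (energy q a (ℓ + ℓ) f) := by
      have h3 := blockAvg_facilitated_le (q := q) (m := ℓ) (d := ℓ) hC
        (fun k hk => H _ (by omega)) a f
      have e : ∀ g, blockAvg q a (ℓ + (ℓ + k * ℓ)) g =
          blockAvg q (a + ℓ + ℓ) (k * ℓ) (blockAvg q a (ℓ + ℓ) g) := fun g => by
        rw [← add_assoc, blockAvg_add a (ℓ + ℓ), Module.End.mul_apply,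
          (commute_blockAvg _ _ _ _).end_apply, Nat.cast_add, add_assoc]
      have h4 := hR.mono h3
      rw [map_smul, ← e, ← e, ← hc, blockAvg_add, Module.End.mul_apply, e1,
        (commute_blockAvg _ _ _ _).end_apply, hPR.end_apply,
        hP.mul_fixed hPc (hP.opVar_fixed f), ← blockAvg_add] at h4
      exact h4
    -- the second term of the induction hypothesis absorbs the error term of `h1`
    have h5 := hP.mono ih
    rw [map_add, map_smul, map_smul, ← Module.End.mul_apply (blockAvg q a ℓ), ← blockAvg_add] at h5
    have h6 : opVar (blockAvg q a (ℓ + (ℓ + k * ℓ))) f =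
        blockAvg q a ℓ (opVar (blockAvg q (a + ℓ) (ℓ + k * ℓ)) f) +
          opVar (blockAvg q a ℓ) (blockAvg q (a + ℓ) (ℓ + k * ℓ) f) := by
      rw [blockAvg_add, IsAveraging.opVar_comp]
    rw [h6, e1 f]
    rw [energy_add, map_add] at h2
    rw [map_add, map_smul] at h5
    rw [map_add, map_smul, energy_add (a + ℓ), map_add]
    intro σ
    have h1 := h1 σ
    have h2 := h2 σ
    have h5 := h5 σ
    have h7 := hP.nonneg _ (hQ.opVar_nonneg (blockAvg q (a + ℓ + ℓ) (k * ℓ) f)) σ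
    have h8 := hP.opVar_nonneg (blockAvg q (a + ℓ) ℓ (blockAvg q (a + ℓ + ℓ) (k * ℓ) f)) σ
    simp only [Pi.add_apply, Pi.smul_apply, smul_eq_mul, Pi.zero_apply] at h1 h2 h5 h7 h8 ⊢
    have h9 := mul_le_mul_of_nonneg_right hℓ (add_nonneg h7 h8)
    linarith

/-! ### The lower bound on the gap -/

lemma dependsOn_siteAvg {f : Config Λ → ℝ} {s : Set Λ} (hf : DependsOn f s) (x : Λ) :
    DependsOn (siteAvg q x f) (s \ {x}) := by
  intro σ τ h
  have : ∀ b, f (Function.update σ x b) = f (Function.update τ x b) := fun b => hf fun i hi => by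
    by_cases hix : i = x
    · subst hix; simp
    · rw [Function.update_of_ne hix, Function.update_of_ne hix, h i ⟨hi, hix⟩]
  rw [siteAvg_apply, siteAvg_apply, this, this]

lemma dependsOn_blockAvg {f : Config Set.univ → ℝ} {s : Set (Set.univ : Set ℤ)}
    (hf : DependsOn f s) (a : ℤ) (n : ℕ) :
    DependsOn (blockAvg q a n f) (s \ {x | a ≤ x ∧ (x : ℤ) < a + n}) := by
  induction n generalizing a with
  | zero => exact DependsOn.mono (fun x hx => ⟨hx, fun h => by
      have := h.1; have := h.2; push_cast at this; omega⟩) hf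
  | succ n ih =>
    refine DependsOn.mono (fun x hx => ?_) (dependsOn_siteAvg (ih (a + 1)) (site a))
    obtain ⟨⟨hx1, hx2⟩, hx3⟩ := hx
    refine ⟨hx1, fun h => ?_⟩
    simp only [Set.mem_ofPred_eq, not_and, not_lt, Set.mem_singleton_iff] at hx2 hx3 h
    have hne : (x : ℤ) ≠ a := fun h => hx3 (Subtype.ext h)
    have := hx2 (by omega)
    push_cast at h
    omega

lemma isLocal_siteAvg {f : Config Λ → ℝ} (hf : IsLocal f) (x : Λ) : IsLocal (siteAvg q x f) := by
  obtain ⟨s, hs⟩ := hf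
  exact ⟨s, (dependsOn_siteAvg hs x).mono Set.sdiff_subset⟩

lemma isLocal_blockAvg {f : Config Set.univ → ℝ} (hf : IsLocal f) (a : ℤ) (n : ℕ) :
    IsLocal (blockAvg q a n f) := by
  obtain ⟨s, hs⟩ := hf
  exact ⟨s, (dependsOn_blockAvg hs a n).mono Set.sdiff_subset⟩

lemma IsLocal.mul {f g : Config Λ → ℝ} (hf : IsLocal f) (hg : IsLocal g) : IsLocal (f * g) := by
  classical
  obtain ⟨s, hs⟩ := hf
  obtain ⟨t, ht⟩ := hg
  refine ⟨s ∪ t, fun σ τ h => ?_⟩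
  rw [Pi.mul_apply, Pi.mul_apply, hs fun i hi => h i (by simp_all),
    ht fun i hi => h i (by simp_all)]

lemma isLocal_opVar_siteAvg {f : Config Λ → ℝ} (hf : IsLocal f) (x : Λ) :
    IsLocal (opVar (siteAvg q x) f) := by
  rw [opVar, sub_eq_add_neg, ← neg_one_smul ℝ, sq, sq]
  exact (isLocal_siteAvg (hf.mul hf) x).add
    (((isLocal_siteAvg hf x).mul (isLocal_siteAvg hf x)).smul _)

lemma isLocal_vac (z : ℤ) : IsLocal (vac z) :=
  ⟨{site z}, fun σ τ h => by rw [vac, vac, h (site z) (by simp)]⟩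

lemma integral_siteAvg {f : Config Λ → ℝ} (hf : IsLocal f) (x : Λ) :
    ∫ σ, siteAvg q x f σ ∂productMeasure q Λ = ∫ σ, f σ ∂productMeasure q Λ := by
  obtain ⟨C, hC⟩ := hf.bounded
  exact (integral_resample x hf.measurable hC).symm

lemma integral_blockAvg {f : Config Set.univ → ℝ} (hf : IsLocal f) (a : ℤ) (n : ℕ) :
    ∫ σ, blockAvg q a n f σ ∂productMeasure q Set.univ =
      ∫ σ, f σ ∂productMeasure q Set.univ := by
  induction n generalizing a with
  | zero => rfl
  | succ n ih =>
    rw [← ih (a + 1)]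
    exact integral_siteAvg (isLocal_blockAvg hf _ _) _

lemma IsLocal.integrable {f : Config Λ → ℝ} (hf : IsLocal f) :
    Integrable f (productMeasure q Λ) :=
  memLp_one_iff_integrable.1 (hf.memLp 1)

/-- The average over a block that contains the support of a function is its expectation. -/
lemma blockAvg_eq_integral {f : Config Set.univ → ℝ} (hf : IsLocal f)
    {s : Set (Set.univ : Set ℤ)} (hs : DependsOn f s) {a : ℤ} {n : ℕ}
    (h : ∀ x ∈ s, a ≤ x ∧ (x : ℤ) < a + n) (σ : Config Set.univ) :
    blockAvg q a n f σ = ∫ τ, f τ ∂productMeasure q Set.univ := by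
  have hd : DependsOn (blockAvg q a n f) ∅ :=
    (dependsOn_blockAvg hs a n).mono fun x hx => hx.2 (h x hx.1)
  rw [← integral_blockAvg hf a n, integral_congr_ae (.of_forall fun τ => hd.empty τ σ)]
  simp

lemma constraint_site (z : ℤ) (σ : Config Set.univ) : constraint (site z) σ = vac (z + 1) σ := by
  rw [constraint, dif_pos (Set.mem_univ _), vac, occ]
  split_ifs <;> norm_num

lemma siteEnergy_site {f : Config Set.univ → ℝ} (hf : IsLocal f) (z : ℤ) :
    siteEnergy q (site z) f = 2 * ENNReal.ofReal
      (∫ σ, (vac (z + 1) * opVar (siteAvg q (site z)) f) σ ∂productMeasure q Set.univ) := by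
  obtain ⟨C, hC⟩ := hf.bounded
  have hm := hf.measurable
  rw [hf.siteEnergy_eq, integral_resample (C := 1 * (C + C) ^ 2) (site z) (by fun_prop),
    show (2 : ℝ≥0∞) = ENNReal.ofReal 2 by simp, ← ENNReal.ofReal_mul (by norm_num),
    ← integral_const_mul]
  · congr 2
    funext σ
    rw [Pi.mul_apply, opVar_siteAvg]
    simp only [flipAt_update, rate, constraint_update, occ, Function.update_self, Bool.not_true,
      Bool.not_false, if_true, Bool.false_eq_true, if_false, constraint_site]
    ring
  · intro σ
    rw [abs_mul, abs_pow]
    gcongr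
    exacts [abs_rate_le_one _ _, (abs_sub _ _).trans (add_le_add (hC _) (hC _))]

lemma integral_energy_le_dirichletForm {f : Config Set.univ → ℝ} (hf : IsLocal f) (a : ℤ) (n : ℕ) :
    ENNReal.ofReal (∫ σ, energy q a n f σ ∂productMeasure q Set.univ) ≤ dirichletForm q f := by
  have hnn : ∀ i : ℕ, 0 ≤ vac (a + i + 1) * opVar (siteAvg q (site (a + i))) f := fun i =>
    mul_nonneg (vac_nonneg _) ((isAveraging_siteAvg _).opVar_nonneg _)
  have hloc : ∀ i : ℕ, IsLocal (vac (a + i + 1) * opVar (siteAvg q (site (a + i))) f) := fun i =>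
    (isLocal_vac _).mul (isLocal_opVar_siteAvg hf _)
  simp only [energy, Finset.sum_apply]
  rw [integral_finsetSum _ fun i _ => (hloc i).integrable, ENNReal.ofReal_sum_of_nonneg
    fun i _ => integral_nonneg (hnn i), East.dirichletForm_eq]
  have hinj : Function.Injective fun i : ℕ => site (a + i) := fun i j h => by
    have := site_injective h
    omega
  calc _ = (1 / 2) * ∑ i ∈ Finset.range n, siteEnergy q (site (a + i)) f := by
        rw [Finset.mul_sum]
        refine Finset.sum_congr rfl fun i _ => ?_
        rw [siteEnergy_site hf, ← mul_assoc, one_div,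
          ENNReal.inv_mul_cancel (by norm_num) (by norm_num), one_mul]
    _ ≤ _ := by
        refine mul_le_mul' le_rfl ?_
        exact (ENNReal.sum_le_tsum _).trans (ENNReal.tsum_comp_le_tsum_of_injective hinj _)

/-- A block inequality at the scale on which empty sites are likely bounds the infinite-volume
gap from below. -/
theorem le_gap_of_blockPoincare (h0 : 0 < q) (h1 : q < 1) {ℓ : ℕ} {C : ℝ} (hC : 0 < C)
    (H : ∀ n < 2 * ℓ, BlockPoincare q n C) (hℓ : (1 - (q : ℝ)) ^ ℓ ≤ 1 / 8) :
    ENNReal.ofReal (8 * C)⁻¹ ≤ gap q Set.univ := by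
  refine (le_gap_iff h0 h1 ENNReal.ofReal_ne_top).2 fun f hf => ?_
  have hℓ0 : 0 < ℓ := Nat.pos_of_ne_zero fun h => by norm_num [h] at hℓ
  obtain ⟨s, hs⟩ := id hf
  obtain ⟨a, k, hak⟩ : ∃ (a : ℤ) (k : ℕ), ∀ x ∈ s, a ≤ x ∧ (x : ℤ) < a + (k * ℓ : ℕ) := by
    obtain ⟨M, hM⟩ : ∃ M : ℕ, ∀ x ∈ s, (x : ℤ).natAbs ≤ M :=
      ⟨s.sup fun x => (x : ℤ).natAbs, fun x hx => Finset.le_sup (f := fun x : (Set.univ : Set ℤ) =>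
        (x : ℤ).natAbs) hx⟩
    refine ⟨-M, 2 * M + 1, fun x hx => ?_⟩
    have h1 := hM x hx
    have h2 : 2 * M + 1 ≤ (2 * M + 1) * ℓ := Nat.le_mul_of_pos_right _ hℓ0
    omega
  set n := ℓ + k * ℓ with hn
  have hfix : blockAvg q (a + (k * ℓ : ℕ)) ℓ f = f := blockAvg_of_siteAvg fun i _ =>
    siteAvg_of_update fun σ b => hs fun x hx => by
      have := (hak x hx).2
      rw [Function.update_of_ne]
      rintro rfl
      simp only at this
      omega
  have hB := isAveraging_blockAvg (q := q) a n
  have hP := isAveraging_blockAvg (q := q) a ℓ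
  have key : opVar (blockAvg q a n) f ≤ (8 * C) • blockAvg q a n (energy q a n f) := by
    have h := opVar_blockAvg_chain hC.le H hℓ k a f hfix
    refine le_trans (le_add_of_nonneg_right (smul_nonneg (by norm_num) (hP.opVar_nonneg _)))
      (h.trans ?_)
    rw [← map_smul, ← map_smul, hn, energy_add]
    refine hB.mono fun σ => ?_
    have h1 := energy_nonneg (q := q) a ℓ f σ
    simp only [Pi.smul_apply, Pi.add_apply, smul_eq_mul, Pi.zero_apply] at h1 ⊢
    nlinarith
  have hs' : ∀ x ∈ (s : Set (Set.univ : Set ℤ)), a ≤ x ∧ (x : ℤ) < a + n := fun x hx => by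
    have := hak x hx
    push_cast [hn] at this ⊢
    omega
  have hf2 : IsLocal (f ^ 2) := sq f ▸ hf.mul hf
  have hs2 : DependsOn (f ^ 2) (s : Set (Set.univ : Set ℤ)) := fun σ τ h => by
    rw [Pi.pow_apply, Pi.pow_apply, hs h]
  have hvar : ∀ σ, opVar (blockAvg q a n) f σ = variance f (productMeasure q Set.univ) :=
    fun σ => by
      rw [variance_eq_sub (hf.memLp 2), opVar, Pi.sub_apply, Pi.pow_apply,
        blockAvg_eq_integral hf hs hs', blockAvg_eq_integral hf2 hs2 hs']
  have hE : IsLocal (energy q a n f) := by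
    unfold energy
    refine Finset.sum_induction _ IsLocal (fun _ _ h h' => h.add h') ⟨∅, fun _ _ _ => rfl⟩ ?_
    exact fun i _ => (isLocal_vac _).mul (isLocal_opVar_siteAvg hf _)
  have hint : variance f (productMeasure q Set.univ) ≤
      8 * C * ∫ σ, energy q a n f σ ∂productMeasure q Set.univ := by
    rw [← integral_blockAvg hE a n, ← integral_const_mul]
    calc _ = ∫ _ : Config Set.univ, variance f (productMeasure q Set.univ)
            ∂productMeasure q Set.univ := by simp
      _ ≤ _ := by
        refine integral_mono (integrable_const _)
          ((isLocal_blockAvg hE a n).integrable.const_mul _) fun σ => ?_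
        have := key σ
        rwa [hvar] at this
  rw [← ofReal_variance (hf.memLp 2), ← ENNReal.ofReal_mul (by positivity)]
  refine le_trans (ENNReal.ofReal_le_ofReal ?_) (integral_energy_le_dirichletForm hf a n)
  rw [inv_mul_le_iff₀ (by positivity)]
  exact hint

/-! ### The bottleneck and the upper bound on the gap -/

section Combinatorics

/-- The point `y` has a point of `X ∪ {0}` at distance at most `r` below it. -/
def Near (X : Finset ℕ) (y r : ℕ) : Prop := ∃ w, (w = 0 ∨ w ∈ X) ∧ w < y ∧ y ≤ w + r

/-- The sets of empty sites, given by their distances to a frozen empty site at `0`, that can be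
dismantled point by point, where a point of a set of `k` points may be removed if there is another
point, or `0`, at distance at most `2 ^ (n - k)` below it. They contain all the sets that the
dynamics can reach from the empty set without exceeding `n` points. -/
inductive Dismantlable (n : ℕ) : Finset ℕ → Prop
  | empty : Dismantlable n ∅
  | of_erase {X : Finset ℕ} {y : ℕ} (hy : y ∈ X) (hn : X.card ≤ n)
      (hr : Near X y (2 ^ (n - X.card))) (h : Dismantlable n (X.erase y)) : Dismantlable n X

lemma Near.mono {X : Finset ℕ} {y r s : ℕ} (h : Near X y r) (hrs : r ≤ s) : Near X y s := by
  obtain ⟨w, hw, h1, h2⟩ := h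
  exact ⟨w, hw, h1, by omega⟩

/-- Removing a point at most doubles the distance to the next point below. -/
lemma Near.erase {X : Finset ℕ} {y z r : ℕ} (hy : Near X y r) (hz : Near X z r) :
    Near (X.erase z) y (2 * r) := by
  obtain ⟨w, hw, h1, h2⟩ := hy
  obtain ⟨v, hv, h3, h4⟩ := hz
  by_cases h : w = z
  · refine ⟨v, hv.imp_right fun hv => Finset.mem_erase.2 ⟨by omega, hv⟩, by omega, by omega⟩
  · exact ⟨w, hw.imp_right fun hw => Finset.mem_erase.2 ⟨h, hw⟩, h1, by omega⟩

lemma Dismantlable.card_le {n : ℕ} {X : Finset ℕ} (h : Dismantlable n X) : X.card ≤ n := by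
  cases h with
  | empty => simp
  | of_erase _ hn => exact hn

/-- Any admissible first removal can be completed to a dismantling order, since the admissible
distance doubles with each removal. -/
lemma Dismantlable.erase {n : ℕ} {X : Finset ℕ} (h : Dismantlable n X) {z : ℕ} (hz : z ∈ X)
    (hr : Near X z (2 ^ (n - X.card))) : Dismantlable n (X.erase z) := by
  induction h with
  | empty => simp at hz
  | @of_erase X y hy hn hry h ih =>
    by_cases hzy : z = y
    · subst hzy; exact h
    · have hpos : 0 < X.card := Finset.card_pos.2 ⟨y, hy⟩
      have hpow : 2 * 2 ^ (n - X.card) = 2 ^ (n - (X.card - 1)) := by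
        rw [← pow_succ']; congr 1; omega
      refine of_erase (y := y) (Finset.mem_erase.2 ⟨fun h => hzy h.symm, hy⟩) ?_ ?_ ?_
      · exact (Finset.card_erase_le).trans hn
      · rw [Finset.card_erase_of_mem hz, ← hpow]
        exact hry.erase hr
      · rw [Finset.erase_right_comm]
        refine ih (Finset.mem_erase.2 ⟨hzy, hz⟩) ?_
        rw [Finset.card_erase_of_mem hy, ← hpow]
        exact hr.erase hry

lemma Dismantlable.insert {n : ℕ} {X : Finset ℕ} (h : Dismantlable n X) (hX : X.card < n) {z : ℕ}
    (hz : z ∉ X) (hr : Near X z 1) : Dismantlable n (insert z X) := by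
  refine of_erase (y := z) (Finset.mem_insert_self _ _) ?_ ?_ (by rwa [Finset.erase_insert hz])
  · rw [Finset.card_insert_of_notMem hz]; exact hX
  · obtain ⟨w, hw, h1, h2⟩ := hr
    exact Near.mono ⟨w, hw.imp_right fun hw => Finset.mem_insert_of_mem hw, h1, h2⟩
      Nat.one_le_two_pow

lemma Dismantlable.add_two_pow_le {n : ℕ} {X : Finset ℕ} (h : Dismantlable n X) :
    ∀ x ∈ X, x + 2 ^ (n - X.card) ≤ 2 ^ n := by
  induction h with
  | empty => simp
  | @of_erase X y hy hn hry h ih =>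
    intro x hx
    have hpos : 0 < X.card := Finset.card_pos.2 ⟨y, hy⟩
    have hpow : 2 ^ (n - (X.card - 1)) = 2 * 2 ^ (n - X.card) := by
      rw [← pow_succ']; congr 1; omega
    rw [Finset.card_erase_of_mem hy, hpow] at ih
    have hle : 2 ^ (n - (X.card - 1)) ≤ 2 ^ n := Nat.pow_le_pow_right (by norm_num) (by omega)
    by_cases hxy : x = y
    · subst hxy
      obtain ⟨w, hw, h1, h2⟩ := hry
      rcases hw with rfl | hw
      · omega
      · have := ih w (Finset.mem_erase.2 ⟨by omega, hw⟩)
        omega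
    · have := ih x (Finset.mem_erase.2 ⟨hxy, hx⟩)
      omega

lemma exists_dismantlable_cover (n k : ℕ) : ∃ S : Finset (Finset ℕ),
    (∀ X, Dismantlable n X → X.card = k → X ∈ S) ∧ (∀ X ∈ S, X.card ≤ k) ∧
      S.card ≤ ∏ j ∈ Finset.range k, (j + 1) * 2 ^ (n - (j + 1)) := by
  induction k with
  | zero => exact ⟨{∅}, fun X _ hX => by simpa using hX, by simp, by simp⟩
  | succ k ih =>
    obtain ⟨S, hS, hSk, hSc⟩ := ih
    refine ⟨S.biUnion fun Y => (insert 0 Y ×ˢ Finset.range (2 ^ (n - (k + 1)))).image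
      fun t => insert (t.1 + t.2 + 1) Y, ?_, ?_, ?_⟩
    · intro X hX hXk
      cases hX with
      | empty => simp at hXk
      | @of_erase _ y hy hn hr h =>
        obtain ⟨w, hw, h1, h2⟩ := hr
        rw [hXk] at h2
        refine Finset.mem_biUnion.2 ⟨X.erase y, hS _ h ?_, Finset.mem_image.2
          ⟨(w, y - w - 1), Finset.mem_product.2 ⟨?_, ?_⟩, ?_⟩⟩
        · rw [Finset.card_erase_of_mem hy]; omega
        · rcases hw with rfl | hw
          · simp
          · exact Finset.mem_insert_of_mem (Finset.mem_erase.2 ⟨by omega, hw⟩)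
        · simp only [Finset.mem_range]; omega
        · rw [show w + (y - w - 1) + 1 = y by omega, Finset.insert_erase hy]
    · intro X hX
      obtain ⟨Y, hY, hXY⟩ := Finset.mem_biUnion.1 hX
      obtain ⟨t, -, rfl⟩ := Finset.mem_image.1 hXY
      exact (Finset.card_insert_le _ _).trans (Nat.succ_le_succ (hSk Y hY))
    · rw [Finset.prod_range_succ]
      refine (Finset.card_biUnion_le_card_mul _ _ ((k + 1) * 2 ^ (n - (k + 1))) fun Y hY => ?_).trans
        (Nat.mul_le_mul_right _ hSc)
      refine Finset.card_image_le.trans ?_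
      rw [Finset.card_product, Finset.card_range]
      exact Nat.mul_le_mul_right _ ((Finset.card_insert_le _ _).trans (Nat.succ_le_succ (hSk Y hY)))

lemma prod_range_mul_two_pow (n : ℕ) :
    ∏ j ∈ Finset.range n, (j + 1) * 2 ^ (n - (j + 1)) = n.factorial * 2 ^ (n * (n - 1) / 2) := by
  rw [Finset.prod_mul_distrib, Finset.prod_range_add_one_eq_factorial, Finset.prod_pow_eq_pow_sum,
    ← Finset.sum_range_id, ← Finset.sum_range_reflect fun j => j]
  congr 2
  exact Finset.sum_congr rfl fun j _ => by omega

end Combinatorics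


/-- The sites at distance `1, …, 2 ^ n` to the left of `0`. -/
abbrev leftSites (n : ℕ) : Set ℤ := Set.Icc (-(2 : ℤ) ^ n) (-1)

lemma card_leftSites (n : ℕ) : Fintype.card (leftSites n) = 2 ^ n := by
  rw [← Set.toFinset_card, Set.toFinset_Icc, Int.card_Icc, ← Nat.cast_inj (R := ℤ)]
  have := pow_pos (show (0 : ℤ) < 2 by norm_num) n
  push_cast
  omega

/-- The set of the distances to `0` of the empty sites. -/
def emptySet {n : ℕ} (σ : Config (leftSites n)) : Finset ℕ :=
  (Finset.univ.filter fun x => σ x = false).image fun x : leftSites n => (x : ℤ).natAbs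

lemma mem_emptySet {n : ℕ} {σ : Config (leftSites n)} (x : leftSites n) :
    (x : ℤ).natAbs ∈ emptySet σ ↔ σ x = false := by
  simp only [emptySet, Finset.mem_image, Finset.mem_filter, Finset.mem_univ, true_and]
  refine ⟨fun ⟨y, hy, hyx⟩ => ?_, fun h => ⟨x, h, rfl⟩⟩
  have : y = x := Subtype.ext (by have := x.2.2; have := y.2.2; omega)
  exact this ▸ hy

lemma exists_of_mem_emptySet {n : ℕ} {σ : Config (leftSites n)} {d : ℕ} (hd : d ∈ emptySet σ) :
    ∃ x : leftSites n, (x : ℤ).natAbs = d ∧ σ x = false := by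
  simp only [emptySet, Finset.mem_image, Finset.mem_filter, Finset.mem_univ, true_and] at hd
  obtain ⟨x, hx, rfl⟩ := hd
  exact ⟨x, rfl, hx⟩

lemma emptySet_flipAt_of_false {n : ℕ} {σ : Config (leftSites n)} {x : leftSites n}
    (hx : σ x = false) : emptySet (flipAt σ x) = (emptySet σ).erase (x : ℤ).natAbs := by
  have hne : ∀ y : leftSites n, y ≠ x → flipAt σ x y = σ y := fun y hy => by
    simp [flipAt, Function.update_of_ne hy]
  ext d
  rw [Finset.mem_erase]
  constructor
  · intro hd
    obtain ⟨y, rfl, hy⟩ := exists_of_mem_emptySet hd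
    have hyx : y ≠ x := by rintro rfl; simp [flipAt, hx] at hy
    refine ⟨fun h => hyx (Subtype.ext ?_), (mem_emptySet y).2 (hne y hyx ▸ hy)⟩
    have := x.2.2; have := y.2.2; omega
  · rintro ⟨hdx, hd⟩
    obtain ⟨y, rfl, hy⟩ := exists_of_mem_emptySet hd
    have hyx : y ≠ x := by rintro rfl; exact hdx rfl
    exact (mem_emptySet y).2 ((hne y hyx).trans hy)

/-- The point of the empty set below an unconstrained site. -/
lemma near_emptySet {n : ℕ} {σ : Config (leftSites n)} {x : leftSites n}
    (hx : constraint x σ ≠ 0) : Near (emptySet σ) (x : ℤ).natAbs 1 := by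
  have h2 := x.2.2
  refine ⟨(x : ℤ).natAbs - 1, ?_, by omega, by omega⟩
  by_cases h : (x : ℤ) + 1 ∈ leftSites n
  · right
    have hσ : σ ⟨x + 1, h⟩ = false := by
      by_contra hσ
      exact hx (by simp [constraint, h, occ, hσ])
    have := (mem_emptySet (σ := σ) ⟨x + 1, h⟩).2 hσ
    have e : ((x : ℤ) + 1).natAbs = (x : ℤ).natAbs - 1 := by omega
    rwa [← e]
  · left
    have := x.2.1
    by_contra h0
    exact h ⟨by omega, by omega⟩

lemma near_flipAt {n : ℕ} {σ : Config (leftSites n)} {x : leftSites n}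
    (h : Near (emptySet σ) (x : ℤ).natAbs 1) :
    Near (emptySet (flipAt σ x)) (x : ℤ).natAbs 1 := by
  obtain ⟨w, hw, h1, h2⟩ := h
  refine ⟨w, hw.imp_right fun hw => ?_, h1, h2⟩
  obtain ⟨y, rfl, hy⟩ := exists_of_mem_emptySet hw
  have hyx : y ≠ x := by rintro rfl; omega
  exact (mem_emptySet y).2 (by simpa [flipAt, Function.update_of_ne hyx] using hy)

/-- A legal flip that enters or leaves the dismantlable sets happens at the maximal number of
empty sites. -/
lemma exists_card_eq_of_exit {n : ℕ} {σ : Config (leftSites n)} {x : leftSites n}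
    (hx : constraint x σ ≠ 0)
    (hne : ¬ (Dismantlable n (emptySet (flipAt σ x)) ↔ Dismantlable n (emptySet σ))) :
    ∃ X ⊆ emptySet σ, Dismantlable n X ∧ X.card = n := by
  have key : ∀ τ : Config (leftSites n), τ x = false → Near (emptySet τ) (x : ℤ).natAbs 1 →
      ¬ (Dismantlable n (emptySet (flipAt τ x)) ↔ Dismantlable n (emptySet τ)) →
      Dismantlable n ((emptySet τ).erase (x : ℤ).natAbs) ∧
        ((emptySet τ).erase (x : ℤ).natAbs).card = n := by
    intro τ hτ hnear hne
    rw [emptySet_flipAt_of_false hτ] at hne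
    have hmem := (mem_emptySet x).2 hτ
    have h1 : Dismantlable n (emptySet τ) → Dismantlable n ((emptySet τ).erase (x : ℤ).natAbs) :=
      fun h => h.erase hmem (hnear.mono Nat.one_le_two_pow)
    have h2 : Dismantlable n ((emptySet τ).erase (x : ℤ).natAbs) := by tauto
    refine ⟨h2, le_antisymm h2.card_le ?_⟩
    by_contra hlt
    have h3 := h2.insert (not_le.1 hlt) (Finset.notMem_erase _ _) (by
      obtain ⟨w, hw, h4, h5⟩ := hnear
      exact ⟨w, hw.imp_right fun hw => Finset.mem_erase.2 ⟨by omega, hw⟩, h4, h5⟩)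
    rw [Finset.insert_erase hmem] at h3
    tauto
  have hnear := near_emptySet hx
  cases hσ : σ x with
  | false =>
    obtain ⟨h1, h2⟩ := key σ hσ hnear hne
    exact ⟨_, Finset.erase_subset _ _, h1, h2⟩
  | true =>
    have hf : flipAt σ x x = false := by simp [flipAt, hσ]
    obtain ⟨h1, h2⟩ := key (flipAt σ x) hf (near_flipAt hnear) (by rw [flipAt_flipAt]; tauto)
    have e := emptySet_flipAt_of_false hf
    rw [flipAt_flipAt] at e
    rw [← e] at h1 h2
    exact ⟨_, subset_rfl, h1, h2⟩

lemma bernoulliMeasure_singleton_true :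
    bernoulliMeasure true false (unitInterval.symm q) {true} = ENNReal.ofReal (1 - q) := by
  rw [bernoulliMeasure_apply_of_mem_of_notMem _ (by simp) (by simp) (by simp),
    coe_toNNReal_eq_ofReal]
  rfl

lemma bernoulliMeasure_singleton_false :
    bernoulliMeasure true false (unitInterval.symm q) {false} = ENNReal.ofReal q := by
  rw [bernoulliMeasure_apply_of_notMem_of_mem _ (by simp) (by simp) (by simp),
    coe_toNNReal_eq_ofReal, unitInterval.symm_symm]

lemma productMeasure_subset_emptySet_le {n : ℕ} (X : Finset ℕ) :
    productMeasure q (leftSites n) {σ | X ⊆ emptySet σ} ≤ ENNReal.ofReal ((q : ℝ) ^ X.card) := by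
  classical
  rcases Set.eq_empty_or_nonempty {σ : Config (leftSites n) | X ⊆ emptySet σ} with h | ⟨τ, hτ⟩
  · simp [h]
  set s : Finset (leftSites n) := Finset.univ.filter fun x => (x : ℤ).natAbs ∈ X with hs
  have hcard : X.card ≤ s.card := by
    refine (Finset.card_le_card (t := s.image fun x : leftSites n => (x : ℤ).natAbs)
      fun d hd => ?_).trans Finset.card_image_le
    obtain ⟨x, rfl, -⟩ := exists_of_mem_emptySet (hτ hd)
    exact Finset.mem_image_of_mem _ (by simpa [hs] using hd)
  calc _ ≤ productMeasure q (leftSites n) (Set.pi s fun _ => {false}) := by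
        refine measure_mono fun σ hσ x hx => ?_
        have : (x : ℤ).natAbs ∈ X := by simpa [hs] using hx
        exact (mem_emptySet x).1 (hσ this)
    _ = ENNReal.ofReal q ^ s.card := by
        rw [productMeasure, Measure.infinitePi_pi _ fun _ _ => by simp]
        simp only [bernoulliMeasure_singleton_false, Finset.prod_const]
    _ ≤ _ := by
        rw [← ENNReal.ofReal_pow q.2.1]
        exact ENNReal.ofReal_le_ofReal (pow_le_pow_of_le_one q.2.1 q.2.2 hcard)

open Classical in
/-- The indicator of the configurations whose set of empty sites is dismantlable. -/
def bottleneck (n : ℕ) (σ : Config (leftSites n)) : ℝ :=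
  if Dismantlable n (emptySet σ) then 1 else 0

lemma isLocal_of_finite {Λ : Set ℤ} [Fintype Λ] (f : Config Λ → ℝ) : IsLocal f :=
  ⟨Finset.univ, fun σ τ h => congrArg f (funext fun x => h x (by simp))⟩

lemma siteEnergy_bottleneck_le (n : ℕ) (x : leftSites n) :
    siteEnergy q x (bottleneck n) ≤
      ENNReal.ofReal ((n.factorial * 2 ^ (n * (n - 1) / 2) : ℕ) * (q : ℝ) ^ n) := by
  classical
  obtain ⟨S, hS, -, hSc⟩ := exists_dismantlable_cover n n
  rw [prod_range_mul_two_pow] at hSc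
  set T := S.filter fun X => X.card = n
  set A : Set (Config (leftSites n)) := ⋃ X ∈ T, {σ | X ⊆ emptySet σ} with hA
  have hAm : MeasurableSet A := Set.Finite.measurableSet (Set.toFinite _)
  calc siteEnergy q x (bottleneck n)
      ≤ ∫⁻ σ, A.indicator 1 σ ∂productMeasure q (leftSites n) := by
        refine lintegral_mono fun σ => ?_
        by_cases hσ : constraint x σ ≠ 0 ∧
            ¬ (Dismantlable n (emptySet (flipAt σ x)) ↔ Dismantlable n (emptySet σ))
        · obtain ⟨X, hXσ, hX, hXn⟩ := exists_card_eq_of_exit hσ.1 hσ.2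
          have hmem : σ ∈ A := Set.mem_biUnion (x := X)
            (Finset.mem_coe.2 (Finset.mem_filter.2 ⟨hS X hX hXn, hXn⟩)) hXσ
          rw [Set.indicator_of_mem hmem, Pi.one_apply, ← ENNReal.ofReal_one]
          refine ENNReal.ofReal_le_ofReal ?_
          have h1 := rate_le_one (q := q) x σ
          have h2 := rate_nonneg (q := q) x σ
          have h3 : (bottleneck n (flipAt σ x) - bottleneck n σ) ^ 2 ≤ 1 := by
            unfold bottleneck; split_ifs <;> norm_num
          nlinarith [sq_nonneg (bottleneck n (flipAt σ x) - bottleneck n σ)]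
        · have : rate q x σ * (bottleneck n (flipAt σ x) - bottleneck n σ) ^ 2 = 0 := by
            rw [not_and_or, not_not, not_not] at hσ
            rcases hσ with h | h
            · simp [rate, h]
            · simp [bottleneck, h]
          simp [this]
    _ = productMeasure q (leftSites n) A := lintegral_indicator_one hAm
    _ ≤ ∑ X ∈ T, productMeasure q (leftSites n) {σ | X ⊆ emptySet σ} := measure_biUnion_finset_le _ _
    _ ≤ ∑ X ∈ T, ENNReal.ofReal ((q : ℝ) ^ n) := Finset.sum_le_sum fun X hX => by
        rw [← (Finset.mem_filter.1 hX).2]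
        exact productMeasure_subset_emptySet_le X
    _ = ENNReal.ofReal (T.card * (q : ℝ) ^ n) := by
        rw [Finset.sum_const, nsmul_eq_mul, ENNReal.ofReal_mul (by positivity),
          ENNReal.ofReal_natCast]
    _ ≤ _ := by
        refine ENNReal.ofReal_le_ofReal (mul_le_mul_of_nonneg_right ?_ (pow_nonneg q.2.1 _))
        exact_mod_cast (Finset.card_filter_le _ _).trans hSc

lemma le_variance_bottleneck (n : ℕ) :
    (1 - (q : ℝ)) ^ 2 ^ n * q ≤ variance (bottleneck n) (productMeasure q (leftSites n)) := by
  have hloc := isLocal_of_finite (bottleneck n)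
  have hsq : bottleneck n ^ 2 = bottleneck n := by
    funext σ; rw [Pi.pow_apply, bottleneck]; split_ifs <;> norm_num
  have h01 : ∀ σ, 0 ≤ bottleneck n σ ∧ bottleneck n σ ≤ 1 := fun σ => by
    unfold bottleneck; split_ifs <;> norm_num
  have hfin : ∀ A : Set (Config (leftSites n)), MeasurableSet A := fun A =>
    Set.Finite.measurableSet (Set.toFinite _)
  rw [variance_eq_sub (hloc.memLp 2), hsq]
  set m := ∫ σ, bottleneck n σ ∂productMeasure q (leftSites n) with hm
  -- the configuration without empty sites is dismantlable
  have h1 : (1 - (q : ℝ)) ^ 2 ^ n ≤ m := by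
    set A : Set (Config (leftSites n)) :=
      Set.pi ((Finset.univ : Finset (leftSites n)) : Set (leftSites n)) fun _ => {true} with hA
    have hAμ : (productMeasure q (leftSites n)).real A = (1 - (q : ℝ)) ^ 2 ^ n := by
      rw [measureReal_def, hA, productMeasure, Measure.infinitePi_pi _ fun _ _ => by simp]
      simp only [bernoulliMeasure_singleton_true, Finset.prod_const, Finset.card_univ, card_leftSites]
      rw [ENNReal.toReal_pow, ENNReal.toReal_ofReal (by linarith [q.2.2])]
    rw [← hAμ, ← integral_indicator_one (hfin A)]
    refine integral_mono ((integrable_const 1).indicator (hfin A)) hloc.integrable fun σ => ?_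
    by_cases hσ : σ ∈ A
    · have he : emptySet σ = ∅ := Finset.eq_empty_of_forall_notMem fun d hd => by
        obtain ⟨x, -, hx⟩ := exists_of_mem_emptySet hd
        have := hσ x (by simp)
        simp [hx] at this
      simp [hσ, bottleneck, he, Dismantlable.empty]
    · simpa [hσ] using (h01 σ).1
  -- a dismantlable configuration is occupied at distance `2 ^ n`
  have h2 : (q : ℝ) ≤ 1 - m := by
    set x₀ : leftSites n := ⟨-(2 : ℤ) ^ n, le_rfl, by
      have := pow_pos (show (0 : ℤ) < 2 by norm_num) n
      omega⟩ with hx₀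
    set B : Set (Config (leftSites n)) :=
      Set.pi (({x₀} : Finset (leftSites n)) : Set (leftSites n)) fun _ => {false} with hB
    have hBμ : (productMeasure q (leftSites n)).real B = q := by
      rw [measureReal_def, hB, productMeasure, Measure.infinitePi_pi _ fun _ _ => by simp]
      rw [Finset.prod_singleton, bernoulliMeasure_singleton_false, ENNReal.toReal_ofReal q.2.1]
    have e : 1 - m = ∫ σ, (1 - bottleneck n σ) ∂productMeasure q (leftSites n) := by
      rw [integral_sub (integrable_const _) hloc.integrable]
      simp [hm]
    rw [e, ← hBμ, ← integral_indicator_one (hfin B)]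
    refine integral_mono ((integrable_const 1).indicator (hfin B))
      ((integrable_const _).sub hloc.integrable) fun σ => ?_
    by_cases hσ : σ ∈ B
    · have hx : σ x₀ = false := by simpa using hσ x₀ (by simp)
      have hmem := (mem_emptySet x₀).2 hx
      have hnd : ¬ Dismantlable n (emptySet σ) := fun h => by
        have := h.add_two_pow_le _ hmem
        have hp : 0 < 2 ^ (n - (emptySet σ).card) := Nat.two_pow_pos _
        have e : (x₀ : ℤ).natAbs = 2 ^ n := by simp [hx₀, Int.natAbs_pow]
        omega
      simp [hσ, bottleneck, hnd]
    · simpa [hσ] using (h01 σ).2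
  have h3 := pow_nonneg (sub_nonneg.2 q.2.2) (2 ^ n)
  have h4 := q.2.1
  calc _ ≤ m * (1 - m) := mul_le_mul h1 h2 h4 (h3.trans h1)
    _ = _ := by ring

/-- The bottleneck at `n` simultaneous empty sites bounds the infinite-volume gap from above. -/
theorem gap_le_bottleneck (h0 : 0 < q) (h1 : q < 1) (n : ℕ) :
    gap q Set.univ ≤ ENNReal.ofReal (2 ^ n * ((n.factorial * 2 ^ (n * (n - 1) / 2) : ℕ) *
      (q : ℝ) ^ n) / ((1 - (q : ℝ)) ^ 2 ^ n * q)) := by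
  have hq0 : (0 : ℝ) < q := h0
  have hq1 : 0 < 1 - (q : ℝ) := sub_pos.2 h1
  refine (gap_anti h0 h1 (Set.subset_univ (leftSites n))).trans ?_
  refine ENNReal.le_of_forall_nnreal_lt fun r hr => ?_
  have hloc := isLocal_of_finite (bottleneck n)
  have h := (le_gap_iff h0 h1 ENNReal.coe_ne_top).1 hr.le _ hloc
  have hD : dirichletForm q (bottleneck n) ≤ ENNReal.ofReal (2 ^ n *
      ((n.factorial * 2 ^ (n * (n - 1) / 2) : ℕ) * (q : ℝ) ^ n)) := by
    rw [dirichletForm_eq, tsum_fintype]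
    calc _ ≤ 1 * ∑ x : leftSites n, ENNReal.ofReal
            ((n.factorial * 2 ^ (n * (n - 1) / 2) : ℕ) * (q : ℝ) ^ n) := by
          refine mul_le_mul' ?_ (Finset.sum_le_sum fun x _ => siteEnergy_bottleneck_le n x)
          rw [one_div]; exact ENNReal.inv_le_one.2 (by norm_num)
      _ = _ := by
          rw [one_mul, Finset.sum_const, Finset.card_univ, card_leftSites, nsmul_eq_mul,
            ENNReal.ofReal_mul (p := 2 ^ n) (by positivity), ENNReal.ofReal_pow (by norm_num)]
          simp
  have hpos : 0 < (1 - (q : ℝ)) ^ 2 ^ n * q := by positivity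
  rw [ENNReal.ofReal_div_of_pos hpos,
    ENNReal.le_div_iff_mul_le (Or.inl (by simpa using hpos)) (Or.inl ENNReal.ofReal_ne_top)]
  refine le_trans ?_ (h.trans hD)
  rw [← ofReal_variance (hloc.memLp 2)]
  gcongr
  exact le_variance_bottleneck n

/-! ### Asymptotics of the gap -/

lemma one_sub_pow_le (q : unitInterval) (d : ℕ) : (1 - (q : ℝ)) ^ d ≤ (1 + (q : ℝ) * d)⁻¹ := by
  have h0 := q.2.1
  have h1 : 0 ≤ 1 - (q : ℝ) := by linarith [q.2.2]
  rw [← one_div, le_div_iff₀ (by positivity)]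
  calc (1 - (q : ℝ)) ^ d * (1 + q * d) ≤ (1 - (q : ℝ)) ^ d * (1 + q) ^ d := by
        gcongr
        have := one_add_mul_le_pow (a := (q : ℝ)) (by linarith) d
        linarith
    _ = (1 - (q : ℝ) ^ 2) ^ d := by rw [← mul_pow]; ring
    _ ≤ 1 := pow_le_one₀ (by nlinarith) (by nlinarith)

/-- Iterated bisection with overlaps of relative length `1 / M`. -/
lemma exists_blockPoincare (h0 : 0 < q) {M : ℕ} (hM : 2 ≤ M) (k : ℕ) :
    ∃ L : ℕ, 1 ≤ L ∧ (2 - 1 / (M : ℝ)) ^ k ≤ L ∧ ∀ n ≤ L, BlockPoincare q n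
      (∏ j ∈ Finset.range k, (4 : ℝ) * (1 + M / ((q : ℝ) * (2 - 1 / (M : ℝ)) ^ j))) := by
  have hq : (0 : ℝ) < q := h0
  have hM0 : (0 : ℝ) < M := by exact_mod_cast (by omega : 0 < M)
  have hr : 0 < 2 - 1 / (M : ℝ) := by
    have : 1 / (M : ℝ) ≤ 1 := by
      rw [div_le_one hM0]; exact_mod_cast (by omega : 1 ≤ M)
    linarith
  induction k with
  | zero =>
    refine ⟨1, le_rfl, by simp, fun n hn => ?_⟩
    interval_cases n
    · exact blockPoincare_zero (by simp)
    · simpa using blockPoincare_one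
  | succ k ih =>
    obtain ⟨L, hL1, hLr, hL⟩ := ih
    set C := ∏ j ∈ Finset.range k, (4 : ℝ) * (1 + M / ((q : ℝ) * (2 - 1 / (M : ℝ)) ^ j)) with hC
    have hC0 : 0 ≤ C := Finset.prod_nonneg fun j _ => by positivity
    set d := ⌈(L : ℝ) / M⌉₊ with hd
    have hL0 : (0 : ℝ) < L := by exact_mod_cast hL1
    have hd0 : 0 < d := Nat.ceil_pos.2 (by positivity)
    have hdL : d ≤ L := Nat.ceil_le.2 (div_le_self hL0.le (by exact_mod_cast (by omega : 1 ≤ M)))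
    have hd1 : (L : ℝ) / M ≤ d := Nat.le_ceil _
    have hd2 : (d : ℝ) < L / M + 1 := Nat.ceil_lt_add_one (by positivity)
    refine ⟨2 * L + 1 - d, by omega, ?_, fun n hn => ?_⟩
    · rw [Nat.cast_sub (by omega), pow_succ]
      push_cast
      calc _ ≤ (L : ℝ) * (2 - 1 / M) := by gcongr
        _ = 2 * L - L / M := by ring
        _ ≤ _ := by linarith
    · refine (BlockPoincare.bisect h0 hC0 hL hd0 hdL n hn).mono ?_
      rw [Finset.prod_range_succ, ← hC]
      set ρ := (2 - 1 / (M : ℝ)) ^ k with hρ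
      have hρ0 : 0 < ρ := pow_pos hr k
      have hqd : 0 < (q : ℝ) * d := by positivity
      have hθ : (q : ℝ) * d / (1 + q * d) ≤ 1 - (1 - (q : ℝ)) ^ d := by
        have h1 := one_sub_pow_le q d
        have e : (q : ℝ) * d / (1 + q * d) = 1 - (1 + (q : ℝ) * d)⁻¹ := by field_simp; ring
        linarith
      have hρd : ρ / M ≤ d := le_trans (by gcongr) hd1
      calc 4 * C / (1 - (1 - (q : ℝ)) ^ d) ≤ 4 * C / (q * d / (1 + q * d)) := by gcongr
        _ = C * (4 * (1 + 1 / (q * d))) := by field_simp; ring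
        _ ≤ C * (4 * (1 + 1 / (q * (ρ / M)))) := by gcongr
        _ = _ := by field_simp

/-- Bisection up to the scale `16 / q`. -/
theorem le_gap_of_pow (h0 : 0 < q) (h1 : q < 1) {M : ℕ} (hM : 2 ≤ M) {K : ℕ}
    (hK : 16 / (q : ℝ) ≤ (2 - 1 / (M : ℝ)) ^ K) :
    ENNReal.ofReal (8 * ∏ j ∈ Finset.range K, (4 : ℝ) * (1 + M / ((q : ℝ) * (2 - 1 / (M : ℝ)) ^ j)))⁻¹ ≤
      gap q Set.univ := by
  have hq : (0 : ℝ) < q := h0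
  have hq1 : (q : ℝ) ≤ 1 := q.2.2
  have hM0 : (0 : ℝ) < M := by exact_mod_cast (by omega : 0 < M)
  have hr : 0 < 2 - 1 / (M : ℝ) := by
    have : 1 / (M : ℝ) ≤ 1 := by
      rw [div_le_one hM0]; exact_mod_cast (by omega : 1 ≤ M)
    linarith
  obtain ⟨L, -, hLr, hL⟩ := exists_blockPoincare h0 hM K
  set ℓ := ⌈7 / (q : ℝ)⌉₊ with hℓ
  have hℓ1 : 7 / (q : ℝ) ≤ ℓ := Nat.le_ceil _
  have hℓ2 : (ℓ : ℝ) < 7 / q + 1 := Nat.ceil_lt_add_one (by positivity)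
  have hℓL : 2 * ℓ ≤ L := by
    have h2 : (1 : ℝ) ≤ 1 / q := by rw [le_div_iff₀ hq]; linarith
    have h3 : 16 / (q : ℝ) = 2 * (7 / q) + 2 * (1 / q) := by ring
    have : ((2 * ℓ : ℕ) : ℝ) ≤ L := by
      push_cast
      linarith
    exact_mod_cast this
  refine le_gap_of_blockPoincare h0 h1 (ℓ := ℓ) (Finset.prod_pos fun j _ => by positivity)
    (fun n hn => hL n (by omega)) ((one_sub_pow_le q ℓ).trans ?_)
  rw [div_le_iff₀ hq] at hℓ1
  rw [one_div]
  exact inv_anti₀ (by norm_num) (by linarith)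

theorem gap_pos (h0 : 0 < q) (h1 : q < 1) : 0 < gap q Set.univ := by
  have hq : (0 : ℝ) < q := h0
  obtain ⟨K, hK⟩ := pow_unbounded_of_one_lt (16 / (q : ℝ))
    (show (1 : ℝ) < 2 - 1 / ((2 : ℕ) : ℝ) by norm_num)
  refine lt_of_lt_of_le (ENNReal.ofReal_pos.2 ?_) (le_gap_of_pow h0 h1 le_rfl hK.le)
  have hr : (0 : ℝ) < 2 - 1 / ((2 : ℕ) : ℝ) := by norm_num
  refine inv_pos.2 (mul_pos (by norm_num) (Finset.prod_pos fun j _ => ?_))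
  positivity

theorem gap_lt_top (h0 : 0 < q) (h1 : q < 1) : gap q Set.univ < ⊤ :=
  (gap_le_bottleneck h0 h1 0).trans_lt ENNReal.ofReal_lt_top

/-- The logarithm of the constant of `le_gap_of_pow`, for the least admissible number of steps
`K = ⌈(log 16 + log (1 / q)) / l⌉`. -/
lemma log_inv_gap_le (h0 : 0 < q) (h1 : q < 1) {M : ℕ} (hM : 2 ≤ M) {l : ℝ}
    (hl : l = Real.log (2 - 1 / (M : ℝ))) :
    Real.log ((gap q Set.univ).toReal⁻¹) ≤
      Real.log 8 + ((Real.log 16 + Real.log (1 / q)) / l + 1) *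
        (Real.log (4 * (16 + M)) + Real.log (1 / q)) -
      (Real.log 16 + Real.log (1 / q)) * (Real.log 16 + Real.log (1 / q) - l) / (2 * l) := by
  have hq : (0 : ℝ) < q := h0
  have hq1 : (q : ℝ) < 1 := h1
  have hM2 : (2 : ℝ) ≤ M := by exact_mod_cast hM
  set r := 2 - 1 / (M : ℝ) with hr
  have hr1 : 1 < r := by
    have : 1 / (M : ℝ) ≤ 1 / 2 := by gcongr
    linarith
  have hr2 : r ≤ 2 := by
    have : 0 ≤ 1 / (M : ℝ) := by positivity
    linarith
  have hr0 : 0 < r := by linarith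
  have hl0 : 0 < l := hl ▸ Real.log_pos hr1
  set t := Real.log (1 / (q : ℝ)) with ht
  have ht0 : 0 ≤ t := Real.log_nonneg (by rw [le_div_iff₀ hq]; linarith)
  set s := Real.log 16 with hs
  set B := Real.log (4 * (16 + M)) with hB
  have hB0 : 0 ≤ B := Real.log_nonneg (by linarith)
  have hsl : l ≤ s := hl ▸ Real.log_le_log hr0 (by linarith)
  set A := (s + t) / l with hA
  have hA1 : 1 ≤ A := by rw [hA, le_div_iff₀ hl0]; linarith
  have hAl : s + t = A * l := by rw [hA]; field_simp
  have h16 : Real.log (16 / (q : ℝ)) = s + t := by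
    rw [div_eq_mul_one_div, Real.log_mul (by norm_num) (by positivity)]
  set K := ⌈A⌉₊ with hK
  have hK1 : A ≤ K := Nat.le_ceil _
  have hK2 : (K : ℝ) < A + 1 := Nat.ceil_lt_add_one (by linarith)
  have hpow : 16 / (q : ℝ) ≤ r ^ K := by
    rw [← Real.log_le_log_iff (by positivity) (by positivity), h16, Real.log_pow, ← hl, hAl]
    gcongr
  have hgap := le_gap_of_pow h0 h1 hM hpow
  set Z := ∏ j ∈ Finset.range K, (4 : ℝ) * (1 + M / ((q : ℝ) * r ^ j)) with hZ
  have hZ0 : 0 < Z := Finset.prod_pos fun j _ => by positivity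
  have hreal : (8 * Z)⁻¹ ≤ (gap q Set.univ).toReal :=
    (ENNReal.ofReal_le_iff_le_toReal (gap_lt_top h0 h1).ne).1 hgap
  have hlogZ : Real.log Z ≤ ∑ j ∈ Finset.range K, (B + t - j * l) := by
    rw [hZ, Real.log_prod fun j _ => by positivity]
    refine Finset.sum_le_sum fun j hj => ?_
    have hjA : (j : ℝ) < A := Nat.lt_ceil.1 (Finset.mem_range.1 hj)
    have hrj : r ^ j ≤ 16 / q := by
      rw [← Real.log_le_log_iff (by positivity) (by positivity), h16, Real.log_pow, ← hl, hAl]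
      gcongr
    have e : B + t - j * l = Real.log (4 * (16 + M) * (1 / q) / r ^ j) := by
      rw [Real.log_div (by positivity) (by positivity), Real.log_mul (by positivity) (by positivity),
        Real.log_pow, ← hl]
    rw [e]
    refine Real.log_le_log (by positivity) ?_
    -- before the last step the scale `r ^ j` is below `16 / q`, so the summand `1` is absorbed
    have h2 : 1 ≤ 16 / (q * r ^ j) := by
      rw [le_div_iff₀ (by positivity)]
      rw [le_div_iff₀ hq] at hrj
      linarith
    calc _ ≤ 4 * (16 / (q * r ^ j) + M / (q * r ^ j)) := by gcongr
      _ = _ := by field_simp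
  have hsum : ∑ j ∈ Finset.range K, (B + t - j * l) = K * (B + t) - K * (K - 1) / 2 * l := by
    have : ∀ m : ℕ, ∑ j ∈ Finset.range m, (B + t - j * l) = m * (B + t) - m * (m - 1) / 2 * l :=
      fun m => by
        induction m with
        | zero => simp
        | succ m ih => rw [Finset.sum_range_succ, ih]; push_cast; ring
    exact this K
  calc Real.log ((gap q Set.univ).toReal⁻¹) ≤ Real.log (8 * Z) := by
        refine Real.log_le_log (inv_pos.2 (lt_of_lt_of_le (by positivity) hreal)) ?_
        rw [inv_le_comm₀ (lt_of_lt_of_le (by positivity) hreal) (by positivity)]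
        exact hreal
    _ = Real.log 8 + Real.log Z := Real.log_mul (by norm_num) hZ0.ne'
    _ ≤ Real.log 8 + (K * (B + t) - K * (K - 1) / 2 * l) := by rw [← hsum]; gcongr
    _ ≤ Real.log 8 + ((A + 1) * (B + t) - A * (A - 1) / 2 * l) := by
        have h1 : (K : ℝ) * (B + t) ≤ (A + 1) * (B + t) :=
          mul_le_mul_of_nonneg_right hK2.le (by linarith)
        have h2 : A * (A - 1) ≤ (K : ℝ) * (K - 1) :=
          mul_le_mul hK1 (by linarith) (by linarith) (by linarith)
        have h3 := mul_le_mul_of_nonneg_right h2 hl0.le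
        linarith
    _ = _ := by rw [hAl]; field_simp; ring

/-- The bound `gap_le_bottleneck` for the largest `n` with `2 ^ n ≤ 1 / q`. -/
lemma le_log_inv_gap (h0 : 0 < q) (h1 : (q : ℝ) ≤ 1 / 2) :
    Real.log (1 / q) ^ 2 / (2 * Real.log 2) - 3 * Real.log (1 / q) - 2 -
      Real.log (1 / q) / Real.log 2 * Real.log (Real.log (1 / q) / Real.log 2) ≤
    Real.log ((gap q Set.univ).toReal⁻¹) := by
  have hq : (0 : ℝ) < q := h0
  have hq1 : q < 1 := by
    have : (q : ℝ) < 1 := by linarith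
    exact this
  have hc : 0 < Real.log 2 := Real.log_pos (by norm_num)
  set c := Real.log 2 with hcdef
  set t := Real.log (1 / (q : ℝ)) with ht
  have htc : c ≤ t := Real.log_le_log (by norm_num) (by rw [le_div_iff₀ hq]; linarith)
  set b := t / c with hb
  have hbt : t = b * c := by rw [hb]; field_simp
  have hb1 : 1 ≤ b := by rw [hb, le_div_iff₀ hc]; linarith
  set n := ⌊b⌋₊ with hn
  have hn1 : (n : ℝ) ≤ b := Nat.floor_le (by linarith)
  have hn2 : b - 1 < n := by linarith [Nat.lt_floor_add_one b]
  have hn0 : 1 ≤ n := Nat.le_floor (by exact_mod_cast hb1)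
  have hn0' : (1 : ℝ) ≤ n := by exact_mod_cast hn0
  have hgap := gap_le_bottleneck h0 hq1 n
  have h1q : 0 < 1 - (q : ℝ) := by linarith
  have hpos : 0 < (gap q Set.univ).toReal :=
    ENNReal.toReal_pos (gap_pos h0 hq1).ne' (gap_lt_top h0 hq1).ne
  have hreal := ENNReal.toReal_le_of_le_ofReal (by positivity) hgap
  have hlog := Real.log_le_log hpos hreal
  push_cast at hlog
  rw [Real.log_div (by positivity) (by positivity), Real.log_mul (by positivity) (by positivity),
    Real.log_mul (by positivity) (by positivity), Real.log_mul (by positivity) (by positivity),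
    Real.log_mul (by positivity) (by positivity), Real.log_pow, Real.log_pow, Real.log_pow,
    Real.log_pow, ← hcdef] at hlog
  have hlq : Real.log q = -t := by rw [ht, one_div, Real.log_inv, neg_neg]
  rw [hlq] at hlog
  have hfact : Real.log n.factorial ≤ b * Real.log b := by
    calc Real.log n.factorial ≤ Real.log ((n : ℝ) ^ n) := by
          refine Real.log_le_log (by positivity) ?_
          exact_mod_cast n.factorial_le_pow
      _ = n * Real.log n := Real.log_pow _ _
      _ ≤ b * Real.log b := by
          have := Real.log_nonneg hn0'
          gcongr
  have hhalf : ((n * (n - 1) / 2 : ℕ) : ℝ) * c ≤ b * t / 2 := by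
    have h2 : ((n * (n - 1) / 2 : ℕ) : ℝ) ≤ (n * (n - 1) : ℕ) / 2 := Nat.cast_div_le
    have h3 : ((n * (n - 1) : ℕ) : ℝ) ≤ b * b := by
      have : ((n - 1 : ℕ) : ℝ) ≤ n := by exact_mod_cast Nat.sub_le n 1
      push_cast
      exact mul_le_mul hn1 (this.trans hn1) (by positivity) (by linarith)
    rw [hbt]
    calc _ ≤ b * b / 2 * c := by gcongr; linarith
      _ = _ := by ring
  have hp : -2 ≤ ((2 ^ n : ℕ) : ℝ) * Real.log (1 - q) := by
    have h2n : (2 : ℝ) ^ n ≤ 1 / q := by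
      rw [← Real.log_le_log_iff (by positivity) (by positivity), Real.log_pow, ← hcdef, ← ht, hbt]
      gcongr
    have hl : -(2 * (q : ℝ)) ≤ Real.log (1 - q) := by
      have := Real.one_sub_inv_le_log_of_pos h1q
      refine le_trans ?_ this
      rw [neg_le_sub_iff_le_add, ← one_div, div_le_iff₀ h1q]
      nlinarith
    push_cast
    rw [le_div_iff₀ hq] at h2n
    have h4 : (0 : ℝ) ≤ 2 ^ n := by positivity
    nlinarith
  have hnc : (n : ℝ) * c ≤ t := by rw [hbt]; gcongr
  have hnt : b * t - t ≤ n * t := by nlinarith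
  have e : t ^ 2 / (2 * c) = b * t / 2 := by rw [hb]; field_simp
  rw [Real.log_inv, e]
  push_cast at hlog hhalf hp ⊢
  linarith

lemma tendsto_log_one_div :
    Tendsto (fun q : unitInterval => Real.log (1 / (q : ℝ))) (𝓝[>] 0) atTop := by
  have h : Tendsto (fun q : unitInterval => (q : ℝ)) (𝓝[>] 0) (𝓝[>] 0) := by
    refine tendsto_nhdsWithin_iff.2 ⟨?_, ?_⟩
    · exact (continuous_subtype_val.tendsto (0 : unitInterval)).mono_left nhdsWithin_le_nhds
    · exact eventually_mem_nhdsWithin.mono fun q hq => hq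
  simp only [one_div]
  exact Real.tendsto_log_atTop.comp (tendsto_inv_nhdsGT_zero.comp h)

lemma tendsto_upper {l : ℝ} (hl : 0 < l) (s B D : ℝ) :
    Tendsto (fun t : ℝ => (D + ((s + t) / l + 1) * (B + t) - (s + t) * (s + t - l) / (2 * l)) / t ^ 2)
      atTop (𝓝 (2 * l)⁻¹) := by
  have hi := tendsto_inv_atTop_zero (𝕜 := ℝ)
  have h := ((tendsto_const_nhds (x := (2 * l)⁻¹)).add
    (hi.const_mul ((s + l + B) / l - (2 * s - l) / (2 * l)))).add
    ((hi.pow 2).const_mul (D + (s + l) * B / l - s * (s - l) / (2 * l)))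
  simp only [mul_zero, add_zero, ne_eq, OfNat.ofNat_ne_zero, not_false_eq_true, zero_pow] at h
  refine h.congr' ?_
  filter_upwards [eventually_gt_atTop 0] with t ht
  field_simp
  ring

lemma tendsto_lower {c : ℝ} (hc : 0 < c) :
    Tendsto (fun t : ℝ => (t ^ 2 / (2 * c) - 3 * t - 2 - t / c * Real.log (t / c)) / t ^ 2)
      atTop (𝓝 (2 * c)⁻¹) := by
  have hi := tendsto_inv_atTop_zero (𝕜 := ℝ)
  have hlog : Tendsto (fun x : ℝ => Real.log x / x) atTop (𝓝 0) :=
    Real.isLittleO_log_id_atTop.tendsto_div_nhds_zero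
  have hlog' : Tendsto (fun t : ℝ => Real.log (t / c) / (t / c)) atTop (𝓝 0) :=
    hlog.comp (tendsto_id.atTop_div_const hc)
  have h := (((tendsto_const_nhds (x := (2 * c)⁻¹)).sub (hi.const_mul 3)).sub
    ((hi.pow 2).const_mul 2)).sub (hlog'.const_mul (c ^ 2)⁻¹)
  simp only [mul_zero, sub_zero, ne_eq, OfNat.ofNat_ne_zero, not_false_eq_true, zero_pow] at h
  refine h.congr' ?_
  filter_upwards [eventually_gt_atTop 0] with t ht
  field_simp

theorem tendsto_log_inv_gap :
    Tendsto (fun q : unitInterval =>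
        Real.log ((gap q Set.univ).toReal⁻¹) / (Real.log (1 / (q : ℝ))) ^ 2)
      (𝓝[>] 0) (𝓝 (2 * Real.log 2)⁻¹) := by
  have hc : 0 < Real.log 2 := Real.log_pos (by norm_num)
  have hpos : ∀ᶠ q : unitInterval in 𝓝[>] 0, 0 < q := eventually_mem_nhdsWithin
  have hhalf : ∀ᶠ q : unitInterval in 𝓝[>] 0, (q : ℝ) < 1 / 2 := by
    have := (continuous_subtype_val.tendsto (0 : unitInterval)).mono_left
      (nhdsWithin_le_nhds (s := Set.Ioi 0))
    exact this.eventually_lt_const (by norm_num)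
  rw [tendsto_order]
  constructor
  · intro a ha
    have hev := ((tendsto_lower hc).comp tendsto_log_one_div).eventually_const_lt ha
    filter_upwards [hev, hpos, hhalf] with q h h0 hh
    refine h.trans_le ?_
    simp only [Function.comp_apply]
    gcongr
    exact le_log_inv_gap h0 hh.le
  · intro a ha
    -- the overlaps can be chosen so short that the bisection rate is close to `2`
    have hM : Tendsto (fun M : ℕ => (2 * Real.log (2 - 1 / (M : ℝ)))⁻¹) atTop
        (𝓝 (2 * Real.log 2)⁻¹) := by
      have h1 : Tendsto (fun M : ℕ => 2 - 1 / (M : ℝ)) atTop (𝓝 2) := by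
        simpa using (tendsto_const_nhds (x := (2 : ℝ))).sub tendsto_one_div_atTop_nhds_zero_nat
      exact ((h1.log (by norm_num)).const_mul 2).inv₀ (by positivity)
    obtain ⟨M, hMa, hM2⟩ := ((hM.eventually_lt_const ha).and (eventually_ge_atTop 2)).exists
    have hM2' : (2 : ℝ) ≤ M := by exact_mod_cast hM2
    have hl : 0 < Real.log (2 - 1 / (M : ℝ)) := by
      refine Real.log_pos ?_
      have : 1 / (M : ℝ) ≤ 1 / 2 := by gcongr
      linarith
    have hev := ((tendsto_upper hl (Real.log 16) (Real.log (4 * (16 + M))) (Real.log 8)).comp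
      tendsto_log_one_div).eventually_lt_const hMa
    filter_upwards [hev, hpos, hhalf] with q h h0 hh
    refine lt_of_le_of_lt ?_ h
    simp only [Function.comp_apply]
    gcongr
    refine log_inv_gap_le h0 ?_ hM2 rfl
    have : (q : ℝ) < 1 := by linarith
    exact this

end East

end

theorem mainTheorem4 :
    (∀ q : unitInterval, 0 < q → q < 1 → 0 < East.gap q Set.univ ∧ East.gap q Set.univ < ⊤) ∧
    Tendsto
      (fun q : unitInterval => Real.log ((East.gap q Set.univ).toReal⁻¹) / (Real.log (1 / (q : ℝ))) ^ 2)
      (𝓝[>] 0) (𝓝 (2 * Real.log 2)⁻¹) ∧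
    (∀ q : unitInterval, 0 < q → q < 1 → ∀ Λ : Set ℤ, Λ.OrdConnected → Λ.Nonempty →
      East.gap q Set.univ ≤ East.gap q Λ) ∧
    (∀ q : unitInterval, 0 < q → q < 1 → ∀ V Λ : Set ℤ, V.OrdConnected → Λ.OrdConnected → V.Nonempty →
      V ⊆ Λ → East.gap q Λ ≤ East.gap q V) :=
  ⟨fun _ h0 h1 => ⟨East.gap_pos h0 h1, East.gap_lt_top h0 h1⟩, East.tendsto_log_inv_gap,
    fun _ h0 h1 _ _ _ => East.gap_anti h0 h1 (Set.subset_univ _),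
    fun _ h0 h1 _ _ _ _ _ h => East.gap_anti h0 h1 h⟩
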